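/- **Setting.** A (binary) schema $\sigma$ is a finite set of binary relation symbols. A graph database over $\sigma$ is a finite $\sigma$-structure, whose nodes are taken from a fixed infinite set of node names. An RPQ $Q$ over $\sigma$ is given by a regular expression over $\sigma$ with language $L(Q)$; its answer $Q(D)$ on a database $D$ is the set of pairs $(x,y)$ of nodes such that some path of $D$ from $x$ to $y$ has its label in $L(Q)$. An RPQ view $V$ from $\sigma$ to $\tau$ consists of one RPQ $V_i$ over $\sigma$ for each symbol $i$ of the schema $\tau$; the view instance $V(D)$ is the database over $\tau$ in which $i$ is interpreted as $V_i(D)$, and whose nodes are those that occur in some fact. $V$ *determines $Q$ in a monotone way* if $V(D)=V(D')$ implies $Q(D)=Q(D')$ and $V(D)\subseteq V(D')$ implies $Q(D)\subseteq Q(D')$, for all databases $D,D'$. A *rewriting* of $Q$ using $V$ is a query $R$ over $\tau$ with $R(V(D))=Q(D)$ for all $D$. Let $A$ be the minimal deterministic automaton of $L(Q)$, with transition function $\delta$, initial state $q_0$ and set $F$ of accepting states. The template $T_{Q,V}$ is the $\tau$-structure whose nodes are the sets of states of $A$, with an $i$-edge from $X$ to $Y$ iff there is $w\in L(V_i)$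 with $\delta(q,w)\in Y$ for all $q\in X$; $X$ is a source node iff $q_0\in X$, and a target node iff $X\cap F=\emptyset$. For $l\le k$, a $\tau$-structure $S$ and nodes $u,v$ of $S$, the $(l,k)$-two-player game on $(S,T_{Q,V},u,v)$ starts with $A_0=\emptyset$ and the empty function $h_0$. In round $j+1$ Player 1 selects a set $A_{j+1}$ of nodes of $S$ with $|A_{j+1}|\le k$ and $|A_j\cap A_{j+1}|\le l$, and Player 2 answers with a homomorphism $h_{j+1}:S[A_{j+1}]\to T_{Q,V}$ that coincides with $h_j$ on $A_j\cap A_{j+1}$ and sends $u$ to a source node and $v$ to a target node whenever these are in $A_{j+1}$. Player 1 wins if at some point Player 2 has no answer. A Datalog query over $\tau$ is a finite set of rules (every variable of the head occurring in the body) with a designated binary goal symbol, evaluated by its least fixpoint. It is in Datalog$_{l,k}$ if its internal symbols have arity at most $l+2$ and each of its rules has at most $k+2$ variables. A *canonical Datalog$_{l,k}$ program* $Q_{l,k}$ for $T_{Q,V}$ is a query in Datalog$_{l,k}$ which, on every graph database $S$ over $\tau$ without isolated nodes, returns exactly the pairs $(u,v)$ of nodes of $S$ such that Player 1 has a winning strategy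 for the $(l,k)$-two-player game on $(S,T_{Q,V},u,v)$. **Theorem.** Let $V$ be an RPQ view from $\sigma$ to $\tau$ such that no language $L(V_i)$ contains the empty word, and let $Q$ be an RPQ over $\sigma$. If $V$ determines $Q$ in a monotone way, then there are an $l$ and a canonical Datalog$_{l,l+1}$ program $Q_{l,l+1}$ for $T_{Q,V}$ such that $Q_{l,l+1}$ is a rewriting of $Q$ using $V$. In particular $Q$ has a rewriting in Datalog using $V$. Moreover this rewriting has polynomial time data complexity: whether $(u,v)\in Q_{l,l+1}(S)$, for a given database $S$ over $\tau$ and nodes $u,v$ of $S$, can be decided on a random access machine (unit cost, with addition and subtraction but no multiplication) in a number of steps that is polynomial in the number of nodes of $S$. -/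

import Mathlib

namespace ViewRewriting

/-! ## Graph databases -/

/-- A graph database over the binary schema `σ`: a finite `σ`-structure, whose nodes are taken from
the (infinite) set `U` of node names. -/
@[ext]
structure GraphDB (σ U : Type*) where
  nodes : Finset U
  edge : σ → U → U → Prop
  left_mem : ∀ {a x y}, edge a x y → x ∈ nodes
  right_mem : ∀ {a x y}, edge a x y → y ∈ nodes

namespace GraphDB

variable {σ U : Type*}

/-- `D.Path x w y`: there is a path in `D` from `x` to `y` whose label is the word `w`. -/
inductive Path (D : GraphDB σ U) : U → List σ → U → Prop
  | nil {x : U} (hx : x ∈ D.nodes) : Path D x [] x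
  | cons {x y z : U} {a : σ} {w : List σ} (h : D.edge a x y) (p : Path D y w z) :
      Path D x (a :: w) z

/-- Inclusion of databases (of their sets of nodes and of each of their relations). -/
def Incl (D D' : GraphDB σ U) : Prop :=
  D.nodes ⊆ D'.nodes ∧ ∀ a x y, D.edge a x y → D'.edge a x y

/-- A node occurring in some fact of the database. -/
def Active (D : GraphDB σ U) (x : U) : Prop :=
  ∃ a y, D.edge a x y ∨ D.edge a y x

/-- Every node of the database occurs in some fact. -/
def NoIsolated (D : GraphDB σ U) : Prop := ∀ x ∈ D.nodes, D.Active x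

end GraphDB

/-! ## Regular path queries and views -/

/-- The answer of a regular path query (given by a regular expression) on a database. -/
def rpqAnswer {σ U : Type*} (Q : RegularExpression σ) (D : GraphDB σ U) : Set (U × U) :=
  {p | ∃ w ∈ Q.matches', D.Path p.1 w p.2}

theorem GraphDB.Path.mem_nodes {σ U : Type*} {D : GraphDB σ U} {x y : U} {w : List σ}
    (p : D.Path x w y) : x ∈ D.nodes ∧ y ∈ D.nodes := by
  induction p with
  | nil hx => exact ⟨hx, hx⟩
  | cons h _ ih => exact ⟨D.left_mem h, ih.2⟩

open Classical in
/-- The view instance `V(D)` of an RPQ view `V` from `σ` to `τ`: the symbol `i` is interpreted as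
the answer of the query `V i` on `D`, and the nodes are those that occur in some fact. -/
noncomputable def viewInstance {σ τ U : Type*} (V : τ → RegularExpression σ) (D : GraphDB σ U) :
    GraphDB τ U where
  nodes := D.nodes.filter fun x => ∃ i y, (x, y) ∈ rpqAnswer (V i) D ∨ (y, x) ∈ rpqAnswer (V i) D
  edge i x y := (x, y) ∈ rpqAnswer (V i) D
  left_mem := by
    rintro i x y ⟨w, hw, p⟩
    exact Finset.mem_filter.2 ⟨p.mem_nodes.1, i, y, Or.inl ⟨w, hw, p⟩⟩
  right_mem := by
    rintro i x y ⟨w, hw, p⟩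
    exact Finset.mem_filter.2 ⟨p.mem_nodes.2, i, x, Or.inr ⟨w, hw, p⟩⟩

/-- `V` determines `Q`: the answer to `Q` depends only on the view instance. -/
def Determines (U : Type*) {σ τ : Type*} (V : τ → RegularExpression σ) (Q : RegularExpression σ) :
    Prop :=
  ∀ D D' : GraphDB σ U, viewInstance V D = viewInstance V D' → rpqAnswer Q D = rpqAnswer Q D'

/-- `V` determines `Q` in a monotone way: `V` determines `Q`, and the induced function
`V(D) ↦ Q(D)` is monotone. -/
def DeterminesMonotonically (U : Type*) {σ τ : Type*} (V : τ → RegularExpression σ)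
    (Q : RegularExpression σ) : Prop :=
  Determines U V Q ∧ ∀ D D' : GraphDB σ U,
    (viewInstance V D).Incl (viewInstance V D') → rpqAnswer Q D ⊆ rpqAnswer Q D'

/-- A query `R` over `τ` is a rewriting of `Q` using `V` if `R(V(D)) = Q(D)` for every `D`. -/
def IsRewriting {σ τ U : Type*} (V : τ → RegularExpression σ) (Q : RegularExpression σ)
    (R : GraphDB τ U → Set (U × U)) : Prop :=
  ∀ D : GraphDB σ U, R (viewInstance V D) = rpqAnswer Q D

/-! ## The template -/

/-- A `τ`-structure with carrier `N`, with distinguished source nodes and target nodes. -/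
structure Template (τ N : Type*) where
  edge : τ → N → N → Prop
  source : Set N
  target : Set N

/-- The template of a view `V` and a deterministic automaton `A`: its nodes are the sets of states
of `A`. There is an edge `i` from `X` to `Y` if some word of the language of `V i` leads from every
state of `X` into `Y`. The sources are the sets containing the initial state, and the
targets are the sets without accepting state. -/
def automatonTemplate {σ τ S : Type*} (A : DFA σ S) (V : τ → RegularExpression σ) :
    Template τ (Set S) where
  edge i X Y := ∃ w ∈ (V i).matches', ∀ q ∈ X, A.evalFrom q w ∈ Y
  source := {X | A.start ∈ X}
  target := {X | ∀ q ∈ X, q ∉ A.accept}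

/-- The template `T_{Q,V}`, built from the minimal deterministic automaton of the language of `Q`
(whose states are the left quotients of that language). -/
def templateQV {σ τ : Type*} (Q : RegularExpression σ) (V : τ → RegularExpression σ) :
    Template τ (Set (Set.range Q.matches'.leftQuotient)) :=
  automatonTemplate Q.matches'.toDFA V

/-! ## The two-player game -/

/-- `h` is a homomorphism from the substructure `S[A]` to the template `T`, sending `u` to a source
node and `v` to a target node whenever these are in `A`. -/
def IsPartialHom {τ U N : Type*} (S : GraphDB τ U) (T : Template τ N) (u v : U) (A : Finset U)
    (h : A → N) : Prop :=
  (∀ i (x y : A), S.edge i x y → T.edge i (h x) (h y)) ∧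
  (∀ x : A, (x : U) = u → h x ∈ T.source) ∧
  (∀ x : A, (x : U) = v → h x ∈ T.target)

open Classical in
/-- Player 1 can force a win of the `(l,k)`-two-player game on `(S, T, u, v)` from the position
`(A, h)`: he can select a set `A'` of at most `k` nodes with `|A ∩ A'| ≤ l` so that, whatever the
answer `h'` of Player 2 (a partial homomorphism on `A'` that coincides with `h` on `A ∩ A'`),
he can force a win from `(A', h')`. In particular he wins at once if Player 2 has no answer. -/
inductive Player1WinsFrom {τ U N : Type*} (l k : ℕ) (S : GraphDB τ U) (T : Template τ N) (u v : U) :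
    (A : Finset U) → (A → N) → Prop
  | move {A : Finset U} {h : A → N} (A' : Finset U) (hA' : A' ⊆ S.nodes) (hk : A'.card ≤ k)
      (hl : (A ∩ A').card ≤ l)
      (win : ∀ h' : A' → N, IsPartialHom S T u v A' h' →
        (∀ x (hx : x ∈ A) (hx' : x ∈ A'), h' ⟨x, hx'⟩ = h ⟨x, hx⟩) →
        Player1WinsFrom l k S T u v A' h') :
      Player1WinsFrom l k S T u v A h

/-- Player 1 has a winning strategy for the `(l,k)`-two-player game on `(S, T, u, v)`. -/
def Player1Wins {τ U N : Type*} (l k : ℕ) (S : GraphDB τ U) (T : Template τ N) (u v : U) : Prop :=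
  Player1WinsFrom l k S T u v ∅ fun x => (Finset.notMem_empty _ x.2).elim

/-! ## Datalog -/

/-- Atoms over the schema `τ` and internal symbols `0, …, n - 1` of the given arities. The variables
are named by natural numbers. -/
inductive DatalogAtom (τ : Type*) {n : ℕ} (arity : Fin n → ℕ)
  | schema (i : τ) (x y : ℕ)
  | internal (I : Fin n) (args : Fin (arity I) → ℕ)

/-- The set of variables of an atom. -/
def DatalogAtom.vars {τ : Type*} {n : ℕ} {arity : Fin n → ℕ} : DatalogAtom τ arity → Finset ℕ
  | .schema _ x y => {x, y}
  | .internal _ args => Finset.univ.image args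

/-- The variables occurring in a list of atoms. -/
def bodyVars {τ : Type*} {n : ℕ} {arity : Fin n → ℕ} (body : List (DatalogAtom τ arity)) :
    Finset ℕ :=
  body.foldr (fun a s => a.vars ∪ s) ∅

/-- A Datalog rule; the variables of its head occur in its body. -/
structure DatalogRule (τ : Type*) {n : ℕ} (arity : Fin n → ℕ) where
  head : Fin n
  headArgs : Fin (arity head) → ℕ
  body : List (DatalogAtom τ arity)
  safe : ∀ j, headArgs j ∈ bodyVars body

/-- A Datalog query over the schema `τ`, with a binary goal. -/
structure DatalogQuery (τ : Type*) where
  numInternal : ℕ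
  arity : Fin numInternal → ℕ
  rules : List (DatalogRule τ arity)
  goal : Fin numInternal
  goal_arity : arity goal = 2

namespace DatalogQuery

variable {τ U : Type*}

/-- The facts over the internal symbols derived by the program on the database `S`: the least
family of relations closed under the rules. -/
inductive Derives (P : DatalogQuery τ) (S : GraphDB τ U) :
    (I : Fin P.numInternal) → (Fin (P.arity I) → U) → Prop
  | rule (r : DatalogRule τ P.arity) (hr : r ∈ P.rules) (ν : ℕ → U)
      (hschema : ∀ i x y, DatalogAtom.schema i x y ∈ r.body → S.edge i (ν x) (ν y))
      (hinternal : ∀ I args, DatalogAtom.internal I args ∈ r.body →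
        Derives P S I fun j => ν (args j)) :
      Derives P S r.head fun j => ν (r.headArgs j)

/-- The output of the query: the content of the goal relation. -/
def eval (P : DatalogQuery τ) (S : GraphDB τ U) : Set (U × U) :=
  {p | P.Derives S P.goal fun j => ![p.1, p.2] (Fin.cast P.goal_arity j)}

/-- The fragment `Datalog_{l,k}` for binary goals: at most `k + 2` variables in each rule, and
internal symbols of arity at most `l + 2`. -/
def InFragment (P : DatalogQuery τ) (l k : ℕ) : Prop :=
  (∀ I, P.arity I ≤ l + 2) ∧ ∀ r ∈ P.rules, (bodyVars r.body).card ≤ k + 2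

/-- `P` is the canonical `Datalog_{l,k}` program of the template `T`: it is in `Datalog_{l,k}`,
and on each graph database given by its facts (so without isolated nodes) it returns the pairs
of nodes for which Player 1 has a winning strategy for the `(l,k)`-two-player game. -/
def IsCanonical (U : Type*) {N : Type*} (P : DatalogQuery τ) (l k : ℕ) (T : Template τ N) : Prop :=
  P.InFragment l k ∧ ∀ S : GraphDB τ U, S.NoIsolated →
    P.eval S = {p | p.1 ∈ S.nodes ∧ p.2 ∈ S.nodes ∧ Player1Wins l k S T p.1 p.2}

end DatalogQuery

/-! ## Polynomial time -/

/-- Programs of a random access machine with finitely many registers (those named in the program),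
an unbounded memory, addition and truncated subtraction. Each elementary instruction and each test
costs one step; as there is no multiplication, polynomial time on this machine is the same
as polynomial time on Turing machines. -/
inductive RamProgram
  | const (r c : ℕ)
  | move (r s : ℕ)
  | add (r s t : ℕ)
  | sub (r s t : ℕ)
  | load (r s : ℕ)
  | store (r s : ℕ)
  | skip
  | seq (p q : RamProgram)
  | ifNonzero (r : ℕ) (p q : RamProgram)
  | whileNonzero (r : ℕ) (p : RamProgram)

/-- A state of the machine: the contents of the registers and of the memory cells. -/
structure RamState where
  reg : ℕ → ℕ
  mem : ℕ → ℕ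

/-- Writing the value `c` into the register `r`. -/
def RamState.setReg (s : RamState) (r c : ℕ) : RamState :=
  { s with reg := Function.update s.reg r c }

/-- `RamExec p s t s'`: started in the state `s`, the program `p` halts after exactly `t` steps in
the state `s'`. -/
inductive RamExec : RamProgram → RamState → ℕ → RamState → Prop
  | const (r c s) : RamExec (.const r c) s 1 (s.setReg r c)
  | move (r a s) : RamExec (.move r a) s 1 (s.setReg r (s.reg a))
  | add (r a b s) : RamExec (.add r a b) s 1 (s.setReg r (s.reg a + s.reg b))
  | sub (r a b s) : RamExec (.sub r a b) s 1 (s.setReg r (s.reg a - s.reg b))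
  | load (r a s) : RamExec (.load r a) s 1 (s.setReg r (s.mem (s.reg a)))
  | store (r a s) :
      RamExec (.store r a) s 1 { s with mem := Function.update s.mem (s.reg r) (s.reg a) }
  | skip (s) : RamExec .skip s 1 s
  | seq {p q s s' s'' m n} (hp : RamExec p s m s') (hq : RamExec q s' n s'') :
      RamExec (.seq p q) s (m + n) s''
  | ifTrue {r p q s s' m} (hr : s.reg r ≠ 0) (hp : RamExec p s m s') :
      RamExec (.ifNonzero r p q) s (m + 1) s'
  | ifFalse {r p q s s' m} (hr : s.reg r = 0) (hq : RamExec q s m s') :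
      RamExec (.ifNonzero r p q) s (m + 1) s'
  | whileStop {r p s} (hr : s.reg r = 0) : RamExec (.whileNonzero r p) s 1 s
  | whileStep {r p s s' s'' m n} (hr : s.reg r ≠ 0) (hp : RamExec p s m s')
      (hw : RamExec (.whileNonzero r p) s' n s'') :
      RamExec (.whileNonzero r p) s (m + n + 1) s''

open Classical in
/-- The initial state encoding a database `S` and two of its nodes `u`, `v`, where the schema is
numbered by `e` and the nodes of `S` are numbered by `f`: the registers `0`, `1`, `2` hold the
number of nodes of `S` and the numbers of `u` and `v`, and the memory holds the adjacency matrices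
of the relations of `S`, one after the other. Everything else is `0`. -/
noncomputable def ramInput {τ U : Type*} {m n : ℕ} (e : τ ≃ Fin m) (S : GraphDB τ U)
    (f : S.nodes ≃ Fin n) (u v : S.nodes) : RamState where
  reg r := if r = 0 then n else if r = 1 then f u else if r = 2 then f v else 0
  mem p := if ∃ (i : τ) (x y : S.nodes), p = ((e i : ℕ) * n + f x) * n + f y ∧ S.edge i x y
    then 1 else 0

open Classical in
/-- The query `R` over the schema `τ` has polynomial time data complexity: some machine program
decides, given a database `S` and nodes `u`, `v` of `S`, whether `(u, v)` is in `R(S)` (leaving the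
answer `1` or `0` in the register `0`) in a number of steps that is polynomial in the number of
nodes of `S`. -/
def PolynomialTimeQuery {τ U : Type*} (R : GraphDB τ U → Set (U × U)) : Prop :=
  ∀ (m : ℕ) (e : τ ≃ Fin m), ∃ (p : RamProgram) (b : Polynomial ℕ),
    ∀ (S : GraphDB τ U) (n : ℕ) (f : S.nodes ≃ Fin n) (u v : S.nodes),
      ∃ (t : ℕ) (s : RamState), RamExec p (ramInput e S f u v) t s ∧ t ≤ b.eval n ∧
        s.reg 0 = if ((u : U), (v : U)) ∈ R S then 1 else 0

end ViewRewriting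

open ViewRewriting

/-! Homomorphisms to the template certify missing answers. If `(u, v)` is not in `Q(D)`, sending
each node to the set of states reached on paths from `u` maps `V(D)` to the template, with `u` at a
source and `v` at a target (`exists_isTemplateHom`). Player 2 survives by following this map, so
every win of Player 1 is an answer of `Q`. Conversely, given a homomorphism on `V(D)`, replace each
view fact by a fresh path labelled with the word behind its image edge. The new database has a
larger view instance and does not return `(u, v)`, so by monotonicity neither does `D`
(`DeterminesMonotonically.not_isTemplateHom`).

The absence of a homomorphism does not by itself give a win with boundedly many pebbles. But if `(u,
v)` is an answer because of a path labelled `w`, then the simple path labelled `w` already returns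
its end points, so its view instance has no homomorphism either. Player 1 sweeps along this path
inside `V(D)`. An earlier position matters for later facts only through the left quotients of the
`L(V_i)` by the factor read since that position, and through its image. One representative for each
pair of such data suffices, and regular languages have finitely many left quotients, so the number
`l` of pebbles kept does not depend on `D` (`player1Wins_or_exists_map`).

The canonical program consists of all rules in `l + 3` variables that are sound for the reading
"Player 1 wins from here". Its soundness is automatic; it is complete because each move of a winning
strategy is an instance of one such rule (`gameHolds_of_player1WinsFrom`). Polynomial time holds for
every Datalog query: over `n` nodes there are at most polynomially many facts, and each round of
naive evaluation adds one or is the last. -/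

section LeftQuotients

/-! ### Regular expressions have finitely many left quotients. -/

open scoped Computability

namespace Language

variable {α : Type*}

/-- The boundary between the two factors lies either beyond `x` or inside it. -/
theorem leftQuotient_mul (L M : Language α) (x : List α) :
    (L * M).leftQuotient x = L.leftQuotient x * M +
      sSup {K | ∃ y z, x = y ++ z ∧ y ∈ L ∧ K = M.leftQuotient z} := by
  ext w
  have hs : w ∈ sSup {K | ∃ y z, x = y ++ z ∧ y ∈ L ∧ K = M.leftQuotient z} ↔
      ∃ y z, x = y ++ z ∧ y ∈ L ∧ z ++ w ∈ M := by
    constructor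
    · rintro ⟨K, ⟨y, z, h1, h2, rfl⟩, hK⟩
      exact ⟨y, z, h1, h2, hK⟩
    · rintro ⟨y, z, h1, h2, h3⟩
      exact ⟨_, ⟨y, z, h1, h2, rfl⟩, h3⟩
  rw [mem_leftQuotient, mem_add, hs, mem_mul, mem_mul]
  constructor
  · rintro ⟨a, ha, b, hb, hab⟩
    rcases List.append_eq_append_iff.1 hab with ⟨c, rfl, rfl⟩ | ⟨c, rfl, rfl⟩
    · exact Or.inr ⟨a, c, rfl, ha, hb⟩
    · exact Or.inl ⟨c, ha, b, hb, rfl⟩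
  · rintro (⟨a, ha, b, hb, rfl⟩ | ⟨y, z, rfl, hy, hz⟩)
    · exact ⟨x ++ a, ha, b, hb, by simp⟩
    · exact ⟨y, hy, z ++ w, hz, by simp⟩

/-- The end of a nonempty `x` lies in some factor: `y` collects the factors before it and `z` is the
part of it inside `x`. For empty `x` there may be no factor at all. -/
theorem leftQuotient_kstar (L : Language α) (x : List α) (hx : x ≠ []) :
    (L∗).leftQuotient x =
      sSup {K | ∃ y z, x = y ++ z ∧ y ∈ L∗ ∧ K = L.leftQuotient z * L∗} := by
  ext w
  have hs : w ∈ sSup {K | ∃ y z, x = y ++ z ∧ y ∈ L∗ ∧ K = L.leftQuotient z * L∗} ↔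
      ∃ y z, x = y ++ z ∧ y ∈ L∗ ∧ w ∈ L.leftQuotient z * L∗ := by
    constructor
    · rintro ⟨K, ⟨y, z, h1, h2, rfl⟩, hK⟩
      exact ⟨y, z, h1, h2, hK⟩
    · rintro ⟨y, z, h1, h2, h3⟩
      exact ⟨_, ⟨y, z, h1, h2, rfl⟩, h3⟩
  rw [hs, mem_leftQuotient]
  constructor
  · rw [mem_kstar]
    rintro ⟨ls, hls, hmem⟩
    clear hs
    induction ls generalizing x with
    | nil => simp_all
    | cons a ls ih =>
      rw [List.flatten_cons] at hls
      rcases List.append_eq_append_iff.1 hls with ⟨c, hc, hw⟩ | ⟨c, hc, hw⟩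
      · refine ⟨[], x, rfl, nil_mem_kstar _, mem_mul.2 ⟨c, ?_, _, join_mem_kstar (L := ls) ?_, hw.symm⟩⟩
        · rw [mem_leftQuotient, ← hc]; exact hmem a (by simp)
        · exact fun y hy => hmem y (by simp [hy])
      -- If `c` is empty, `a` ends together with `x` and serves as the straddling factor.
      · by_cases hc0 : c = []
        · subst hc0
          refine ⟨[], x, rfl, nil_mem_kstar _, mem_mul.2 ⟨[], ?_, w, ?_, rfl⟩⟩
          · rw [mem_leftQuotient, hc]
            simpa using hmem a (by simp)
          · simp only [List.nil_append] at hw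
            rw [← hw]
            exact join_mem_kstar fun y hy => hmem y (by simp [hy])
        · obtain ⟨y, z, rfl, hy, hz⟩ := ih c hc0 hw.symm fun y hy => hmem y (by simp [hy])
          obtain ⟨l, rfl, hl⟩ := mem_kstar.1 hy
          refine ⟨a ++ l.flatten, z, by simp [hc], ?_, hz⟩
          exact join_mem_kstar (L := a :: l) (by simpa using ⟨hmem a (by simp), hl⟩)
  · rintro ⟨y, z, rfl, hy, hz⟩
    obtain ⟨a, ha, b, hb, rfl⟩ := mem_mul.1 hz
    obtain ⟨l, rfl, hl⟩ := mem_kstar.1 hy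
    obtain ⟨m, rfl, hm⟩ := mem_kstar.1 hb
    refine mem_kstar.2 ⟨l ++ (z ++ a) :: m, by simp, ?_⟩
    intro y hy
    rcases List.mem_append.1 hy with h | h
    · exact hl y h
    · rcases List.mem_cons.1 h with rfl | h
      · exact ha
      · exact hm y h

end Language

/-- The splittings of `x` are unbounded in number, but the suprema they produce are over subsets of
a finite set of languages, so only finitely many values occur. -/
theorem RegularExpression.finite_range_leftQuotient {α : Type*} (P : RegularExpression α) :
    (Set.range P.matches'.leftQuotient).Finite := by
  induction P with
  | zero =>
    refine (Set.finite_singleton (0 : Language α)).subset ?_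
    rintro _ ⟨x, rfl⟩
    rfl
  | epsilon =>
    refine (Set.toFinite {(1 : Language α), 0}).subset ?_
    rintro _ ⟨x, rfl⟩
    cases x with
    | nil => exact Or.inl rfl
    | cons a x =>
      refine Or.inr (Set.eq_empty_of_forall_notMem fun w hw => ?_)
      exact absurd (show a :: x ++ w = [] from hw) (by simp)
  | char a =>
    refine (Set.toFinite {({[a]} : Language α), 1, 0}).subset ?_
    rintro _ ⟨x, rfl⟩
    cases x with
    | nil => exact Or.inl rfl
    | cons b x =>
      by_cases h : b :: x = [a]
      · refine Or.inr (Or.inl ?_)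
        rw [h]
        ext w
        change [a] ++ w = [a] ↔ w = []
        simp
      · refine Or.inr (Or.inr (Set.eq_empty_of_forall_notMem fun w hw => ?_))
        have hw : b :: x ++ w = [a] := hw
        simp_all
  | plus P Q hP hQ =>
    refine (Set.Finite.image2 (· + ·) hP hQ).subset ?_
    rintro _ ⟨x, rfl⟩
    exact ⟨_, ⟨x, rfl⟩, _, ⟨x, rfl⟩, rfl⟩
  | comp P Q hP hQ =>
    refine (Set.Finite.image2 (fun A B => A * Q.matches' + sSup B) hP hQ.finite_subsets).subset ?_
    rintro _ ⟨x, rfl⟩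
    refine ⟨_, ⟨x, rfl⟩, _, ?_, (Language.leftQuotient_mul _ _ x).symm⟩
    rintro _ ⟨y, z, -, -, rfl⟩
    exact ⟨z, rfl⟩
  | star P hP =>
    refine (((hP.image fun A => A * P.matches'∗).finite_subsets.image sSup).insert
      P.matches'∗).subset ?_
    rintro _ ⟨x, rfl⟩
    by_cases hx : x = []
    · subst hx; exact Or.inl rfl
    · refine Or.inr ⟨_, ?_, (Language.leftQuotient_kstar _ x hx).symm⟩
      rintro _ ⟨y, z, -, -, rfl⟩
      exact ⟨_, ⟨z, rfl⟩, rfl⟩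

end LeftQuotients

namespace ViewRewriting

/-! ### View instances, and invariance under renaming of nodes. -/

section Paths

variable {σ τ U : Type*}

theorem GraphDB.Path.append {D : GraphDB σ U} {x y z : U} {v w : List σ}
    (p : D.Path x v y) (q : D.Path y w z) : D.Path x (v ++ w) z := by
  induction p with
  | nil => exact q
  | cons h _ ih => exact .cons h (ih q)

theorem GraphDB.Path.mono {D D' : GraphDB σ U} (h : D.Incl D') {x y : U} {w : List σ}
    (p : D.Path x w y) : D'.Path x w y := by
  induction p with
  | nil hx => exact .nil (h.1 hx)
  | cons he _ ih => exact .cons (h.2 _ _ _ he) ih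

theorem GraphDB.Path.map {D D' : GraphDB σ U} {f : U → U} (hn : ∀ x ∈ D.nodes, f x ∈ D'.nodes)
    (h : ∀ a x y, D.edge a x y → D'.edge a (f x) (f y)) {x y : U} {w : List σ}
    (p : D.Path x w y) : D'.Path (f x) w (f y) := by
  induction p with
  | nil hx => exact .nil (hn _ hx)
  | cons he _ ih => exact .cons (h _ _ _ he) ih

theorem viewInstance_noIsolated (V : τ → RegularExpression σ) (D : GraphDB σ U) :
    (viewInstance V D).NoIsolated := by
  classical
  intro x hx
  exact (Finset.mem_filter.1 hx).2

theorem viewInstance_nodes_subset (V : τ → RegularExpression σ) (D : GraphDB σ U) :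
    (viewInstance V D).nodes ⊆ D.nodes := by
  classical
  exact Finset.filter_subset _ _

theorem mem_nodes_viewInstance {V : τ → RegularExpression σ} {D : GraphDB σ U} {x : U} :
    x ∈ (viewInstance V D).nodes ↔ (viewInstance V D).Active x := by
  refine ⟨viewInstance_noIsolated V D x, ?_⟩
  rintro ⟨i, y, h | h⟩
  · exact (viewInstance V D).left_mem h
  · exact (viewInstance V D).right_mem h

theorem viewInstance_eq_of_edge {V : τ → RegularExpression σ} {D D' : GraphDB σ U}
    (h : ∀ i x y, (viewInstance V D).edge i x y ↔ (viewInstance V D').edge i x y) :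
    viewInstance V D = viewInstance V D' := by
  ext x
  · simp only [mem_nodes_viewInstance, GraphDB.Active, h]
  · exact h _ _ _

theorem viewInstance_incl_of_edge {V : τ → RegularExpression σ} {D D' : GraphDB σ U}
    (h : ∀ i x y, (viewInstance V D).edge i x y → (viewInstance V D').edge i x y) :
    (viewInstance V D).Incl (viewInstance V D') := by
  refine ⟨fun x hx => ?_, h⟩
  obtain ⟨i, y, e | e⟩ := viewInstance_noIsolated V D x hx
  · exact (viewInstance V D').left_mem (h _ _ _ e)
  · exact (viewInstance V D').right_mem (h _ _ _ e)

/-- Renaming the nodes of a database. -/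
def GraphDB.rename (D : GraphDB σ U) (e : Equiv.Perm U) : GraphDB σ U where
  nodes := D.nodes.map e.toEmbedding
  edge a x y := D.edge a (e.symm x) (e.symm y)
  left_mem h := Finset.mem_map_equiv.2 (D.left_mem h)
  right_mem h := Finset.mem_map_equiv.2 (D.right_mem h)

theorem GraphDB.path_rename {D : GraphDB σ U} {e : Equiv.Perm U} {x y : U} {w : List σ} :
    (D.rename e).Path x w y ↔ D.Path (e.symm x) w (e.symm y) := by
  constructor
  · exact fun p => p.map (fun x hx => Finset.mem_map_equiv.1 hx) fun _ _ _ h => h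
  · intro p
    have := p.map (D' := D.rename e) (f := e) (fun x hx => Finset.mem_map_of_mem _ hx)
      (fun a x y h => by simpa [rename] using h)
    simpa using this

theorem edge_viewInstance_rename {V : τ → RegularExpression σ} {D : GraphDB σ U}
    {e : Equiv.Perm U} {i : τ} {x y : U} :
    (viewInstance V (D.rename e)).edge i x y ↔
      (viewInstance V D).edge i (e.symm x) (e.symm y) := by
  simp only [viewInstance, rpqAnswer, GraphDB.path_rename, Set.mem_ofPred_eq]

/-- A determined query only returns nodes of the view instance. -/
theorem Determines.mem_nodes [Infinite U] {V : τ → RegularExpression σ} {Q : RegularExpression σ}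
    (h : Determines U V Q) {D : GraphDB σ U} {u v : U} (huv : (u, v) ∈ rpqAnswer Q D) :
    u ∈ (viewInstance V D).nodes ∧ v ∈ (viewInstance V D).nodes := by
  classical
  suffices key : ∀ z, z = u ∨ z = v → z ∈ (viewInstance V D).nodes from
    ⟨key u (.inl rfl), key v (.inr rfl)⟩
  intro z hz
  by_contra hzV
  -- Swapping `z` with a name `z'` outside `D` fixes all nodes of the view instance, hence the view
  -- instance and the answer of `Q`. But the renamed database no longer contains `z`.
  obtain ⟨z', hz'⟩ := Infinite.exists_notMem_finset D.nodes
  have hz'V : z' ∉ (viewInstance V D).nodes := fun h => hz' (viewInstance_nodes_subset V D h)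
  have hfix : ∀ x, x ∈ (viewInstance V D).nodes → Equiv.swap z z' x = x := fun x hx =>
    Equiv.swap_apply_of_ne_of_ne (fun h => hzV (h ▸ hx)) (fun h => hz'V (h ▸ hx))
  have hQ := h D (D.rename (Equiv.swap z z')) <| viewInstance_eq_of_edge fun i x y => by
    rw [edge_viewInstance_rename, Equiv.symm_swap]
    constructor
    · intro e
      rwa [hfix x (GraphDB.left_mem _ e), hfix y (GraphDB.right_mem _ e)]
    · intro e
      have hx := hfix _ (GraphDB.left_mem _ e)
      have hy := hfix _ (GraphDB.right_mem _ e)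
      rw [Equiv.swap_apply_self] at hx hy
      rwa [← hx, ← hy] at e
  rw [hQ] at huv
  obtain ⟨w, -, p⟩ := huv
  have hzn : z ∈ (D.rename (Equiv.swap z z')).nodes := by
    rcases hz with rfl | rfl
    · exact p.mem_nodes.1
    · exact p.mem_nodes.2
  have := Finset.mem_map_equiv.1 hzn
  rw [Equiv.symm_swap, Equiv.swap_apply_left] at this
  exact hz' this

end Paths

/-! ### Homomorphisms to the template and missing answers. -/

section Homomorphisms

variable {σ τ U N : Type*}

/-- `h` is a homomorphism from `S` to `T` that sends `u` to a source node and `v` to a target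
node. -/
structure IsTemplateHom (S : GraphDB τ U) (T : Template τ N) (u v : U) (h : U → N) : Prop where
  edge : ∀ i x y, S.edge i x y → T.edge i (h x) (h y)
  source : h u ∈ T.source
  target : h v ∈ T.target

/-- Player 2 always answers with the restriction of `h`; a win of Player 1 is a well-founded tree,
so following these answers contradicts it by induction. -/
theorem IsTemplateHom.not_player1WinsFrom {l k : ℕ} {S : GraphDB τ U} {T : Template τ N} {u v : U}
    {h : U → N} (hh : IsTemplateHom S T u v h) {A : Finset U} {g : A → N}
    (hg : ∀ x : A, g x = h x) : ¬ Player1WinsFrom l k S T u v A g := by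
  intro hw
  induction hw with
  | move A' _ _ _ _ ih =>
    refine ih (fun x => h x) ⟨fun i x y => hh.edge i x y, ?_, ?_⟩ (fun x hx _ => (hg ⟨x, hx⟩).symm)
      fun _ => rfl
    · rintro x rfl
      exact hh.source
    · rintro x rfl
      exact hh.target

theorem IsTemplateHom.not_player1Wins {l k : ℕ} {S : GraphDB τ U} {T : Template τ N} {u v : U}
    {h : U → N} (hh : IsTemplateHom S T u v h) : ¬ Player1Wins l k S T u v :=
  hh.not_player1WinsFrom fun x => (Finset.notMem_empty _ x.2).elim

/-- A database on which the answer of `Q` misses `(u, v)` maps to the template: a node is sent to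
the set of states that are reached along the paths from `u`. -/
theorem exists_isTemplateHom (V : τ → RegularExpression σ) (Q : RegularExpression σ)
    {D : GraphDB σ U} {u v : U} (hu : u ∈ D.nodes) (huv : (u, v) ∉ rpqAnswer Q D) :
    ∃ h, IsTemplateHom (viewInstance V D) (templateQV Q V) u v h := by
  refine ⟨fun x => {q | ∃ w, D.Path u w x ∧ Q.matches'.toDFA.eval w = q}, ?_, ?_, ?_⟩
  · rintro i x y ⟨w, hw, p⟩
    refine ⟨w, hw, ?_⟩
    rintro _ ⟨w', p', rfl⟩
    exact ⟨w' ++ w, p'.append p, DFA.evalFrom_of_append _ _ _ _⟩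
  · exact ⟨[], .nil hu, rfl⟩
  · rintro _ ⟨w, p, rfl⟩ hacc
    refine huv ⟨w, ?_, p⟩
    rw [← Q.matches'.accepts_toDFA]
    exact hacc

/-- The labels of the nodes of `D` by sets of states of `A` are compatible with the edges. -/
def GraphDB.Compatible {S : Type*} (D : GraphDB σ U) (A : DFA σ S) (g : U → Set S) : Prop :=
  ∀ a x y, D.edge a x y → ∀ q ∈ g x, A.step q a ∈ g y

/-- A compatible labelling thus excludes an answer: if the initial state is in the label of `u` and
no accepting state is in that of `v`, no path from `u` to `v` is accepted. -/
theorem GraphDB.Compatible.evalFrom_mem {S : Type*} {D : GraphDB σ U} {A : DFA σ S}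
    {g : U → Set S} (hg : D.Compatible A g) {x y : U} {w : List σ} (p : D.Path x w y)
    {q : S} (hq : q ∈ g x) : A.evalFrom q w ∈ g y := by
  induction p generalizing q with
  | nil => exact hq
  | cons h _ ih => exact ih (hg _ _ _ h q hq)

/-- A path with a given nonempty label, with fresh inner nodes, can be added to a database. -/
theorem GraphDB.Compatible.exists_addPath [Infinite U] {S : Type*} {A : DFA σ S} {w : List σ}
    (hw : w ≠ []) {D : GraphDB σ U} {g : U → Set S} (hg : D.Compatible A g) {x y : U}
    (hx : x ∈ D.nodes) (hy : y ∈ D.nodes) (hxy : ∀ q ∈ g x, A.evalFrom q w ∈ g y) :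
    ∃ (D' : GraphDB σ U) (g' : U → Set S), D.Incl D' ∧ D'.Compatible A g' ∧
      (∀ z ∈ D.nodes, g' z = g z) ∧ D'.Path x w y := by
  classical
  induction w generalizing D g x with
  -- An empty label would force `x = y`, which no addition of nodes can achieve.
  | nil => exact absurd rfl hw
  | cons a w ih =>
    by_cases hw0 : w = []
    · subst hw0
      refine ⟨⟨D.nodes, fun b z t => D.edge b z t ∨ (b = a ∧ z = x ∧ t = y), ?_, ?_⟩, g,
        ⟨subset_rfl, fun _ _ _ => .inl⟩, ?_, fun _ _ => rfl,
        .cons (.inr ⟨rfl, rfl, rfl⟩) (.nil hy)⟩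
      · rintro b z t (h | ⟨-, rfl, -⟩)
        exacts [D.left_mem h, hx]
      · rintro b z t (h | ⟨-, -, rfl⟩)
        exacts [D.right_mem h, hy]
      · rintro b z t (h | ⟨rfl, rfl, rfl⟩)
        exacts [hg _ _ _ h, hxy]
    · obtain ⟨f, hf⟩ := Infinite.exists_notMem_finset D.nodes
      have hne : ∀ {z}, z ∈ D.nodes → z ≠ f := fun hz h => hf (h ▸ hz)
      let D₁ : GraphDB σ U :=
        ⟨insert f D.nodes, fun b z t => D.edge b z t ∨ (b = a ∧ z = x ∧ t = f), by
          rintro b z t (h | ⟨-, rfl, -⟩)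
          exacts [Finset.mem_insert_of_mem (D.left_mem h), Finset.mem_insert_of_mem hx], by
          rintro b z t (h | ⟨-, -, rfl⟩)
          exacts [Finset.mem_insert_of_mem (D.right_mem h), Finset.mem_insert_self _ _]⟩
      have hD₁ : D.Incl D₁ := ⟨Finset.subset_insert _ _, fun _ _ _ => .inl⟩
      -- The fresh node gets the least label compatible with the new edge, so the assumption on `a
      -- :: w` from `x` becomes the one on `w` from `f`.
      let g₁ := Function.update g f {q | ∃ r ∈ g x, A.step r a = q}
      have hg₁ : ∀ z ∈ D.nodes, g₁ z = g z := fun z hz => Function.update_of_ne (hne hz) _ _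
      have hg₁f : g₁ f = {q | ∃ r ∈ g x, A.step r a = q} := Function.update_self _ _ _
      obtain ⟨D', g', h1, h2, h3, h4⟩ := ih hw0 (D := D₁) (g := g₁) (x := f) (by
        rintro b z t (h | ⟨rfl, rfl, rfl⟩) q hq
        · rw [hg₁ _ (D.left_mem h)] at hq
          rw [hg₁ _ (D.right_mem h)]
          exact hg _ _ _ h q hq
        · rw [hg₁ _ hx] at hq
          rw [hg₁f]
          exact ⟨q, hq, rfl⟩) (Finset.mem_insert_self _ _) (hD₁.1 hy) (by
        rw [hg₁f, hg₁ _ hy]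
        rintro _ ⟨r, hr, rfl⟩
        exact hxy r hr)
      refine ⟨D', g', ⟨hD₁.1.trans h1.1, fun b z t h => h1.2 _ _ _ (hD₁.2 _ _ _ h)⟩, h2,
        fun z hz => (h3 z (hD₁.1 hz)).trans (hg₁ z hz), .cons (h1.2 _ _ _ (.inr ⟨rfl, rfl, rfl⟩)) h4⟩

theorem GraphDB.finite_edges [Finite τ] (S : GraphDB τ U) :
    {e : τ × U × U | S.edge e.1 e.2.1 e.2.2}.Finite := by
  refine ((Set.toFinite (Set.univ : Set τ)).prod
    (S.nodes.finite_toSet.prod S.nodes.finite_toSet)).subset ?_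
  rintro ⟨i, x, y⟩ h
  exact ⟨trivial, S.left_mem h, S.right_mem h⟩

/-- If `V` determines `Q` in a monotone way, then the view instance of a database on which `Q`
returns `(u, v)` does not map to the template. -/
theorem DeterminesMonotonically.not_isTemplateHom [Infinite U] [Finite τ]
    {V : τ → RegularExpression σ} {Q : RegularExpression σ} (hV : ∀ i, [] ∉ (V i).matches')
    (hVQ : DeterminesMonotonically U V Q) {D : GraphDB σ U} {u v : U}
    (huv : (u, v) ∈ rpqAnswer Q D) (h : U → Set (Set.range Q.matches'.leftQuotient)) :
    ¬ IsTemplateHom (viewInstance V D) (templateQV Q V) u v h := by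
  intro hh
  -- Start from the nodes of `D` without edges and add one fresh path per view fact, labelled by the
  -- word that witnesses its image edge. Old nodes keep the label `h`.
  have key : ∀ E : Set (τ × U × U), E.Finite →
      E ⊆ {e | (viewInstance V D).edge e.1 e.2.1 e.2.2} →
      ∃ (D' : GraphDB σ U) (g : U → Set (Set.range Q.matches'.leftQuotient)),
        D.nodes ⊆ D'.nodes ∧ (∀ z ∈ D.nodes, g z = h z) ∧
        D'.Compatible Q.matches'.toDFA g ∧ ∀ e ∈ E, (viewInstance V D').edge e.1 e.2.1 e.2.2 := by
    intro E hE
    induction E, hE using Set.Finite.induction_on with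
    | empty =>
      exact fun _ => ⟨⟨D.nodes, fun _ _ _ => False, False.elim, False.elim⟩, h, subset_rfl,
        fun _ _ => rfl, fun _ _ _ => False.elim, fun _ => False.elim⟩
    | @insert e E _ _ ih =>
      intro hE
      obtain ⟨D₁, g₁, h1, h2, h3, h4⟩ := ih ((Set.subset_insert _ _).trans hE)
      obtain ⟨i, x, y⟩ := e
      have hxy : (viewInstance V D).edge i x y := hE (Set.mem_insert _ _)
      have hx : x ∈ D.nodes := viewInstance_nodes_subset V D ((viewInstance V D).left_mem hxy)
      have hy : y ∈ D.nodes := viewInstance_nodes_subset V D ((viewInstance V D).right_mem hxy)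
      obtain ⟨w, hw, hwe⟩ := hh.edge i x y hxy
      rw [← h2 x hx, ← h2 y hy] at hwe
      obtain ⟨D₂, g₂, h5, h6, h7, h8⟩ :=
        h3.exists_addPath (fun h0 => hV i (h0 ▸ hw)) (h1 hx) (h1 hy) hwe
      refine ⟨D₂, g₂, h1.trans h5.1, fun z hz => (h7 z (h1 hz)).trans (h2 z hz), h6, ?_⟩
      rintro _ (rfl | he)
      · exact ⟨w, hw, h8⟩
      · obtain ⟨w', hw', p⟩ := h4 _ he
        exact ⟨w', hw', p.mono h5⟩
  obtain ⟨D', g, -, h2, h3, h4⟩ := key _ (viewInstance V D).finite_edges subset_rfl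
  -- By monotonicity `D'` has an accepted path from `u` to `v`; it would carry the initial state in
  -- `h u` to an accepting state in the target `h v`.
  obtain ⟨w, hw, p⟩ := hVQ.2 D D' (viewInstance_incl_of_edge fun i x y e => h4 (i, x, y) e) huv
  obtain ⟨_, -, p₀⟩ := huv
  have hmem := h3.evalFrom_mem p (q := Q.matches'.toDFA.start) (by
    rw [h2 u p₀.mem_nodes.1]
    exact hh.source)
  change _ ∈ g v at hmem
  rw [h2 v p₀.mem_nodes.2] at hmem
  refine hh.target _ hmem ?_
  rw [← Q.matches'.accepts_toDFA] at hw
  exact hw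

end Homomorphisms

/-! ### Player 1's sweep along a path with boundedly many pebbles. -/

section Sweep

variable {σ τ U N : Type*}

/-- Player 1 sweeps through the positions `0, …, n` of a path, keeping one representative of each
pair of a class (`cls p q` is the class of the position `p` seen from the position `q`) and an
image. He wins unless the structure of the positions is mapped to the template. -/
theorem player1Wins_or_exists_map {C : Type*} [Finite C] [Finite N] [Nonempty N]
    (S : GraphDB τ U) (T : Template τ N) (n : ℕ) (z : ℕ → U) (cls : ℕ → ℕ → C)
    (E : τ → ℕ → ℕ → Prop) (hE : ∀ i p q, p < q → q ≤ n → E i p q → S.edge i (z p) (z q))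
    (hcls : ∀ p p' q, p ≤ q → p' ≤ q → cls p q = cls p' q → cls p (q + 1) = cls p' (q + 1))
    (hEc : ∀ i p p' q, p < q → p' < q → cls p q = cls p' q → E i p q → E i p' q)
    (h0 : z 0 ∈ S.nodes) (hn : z n ∈ S.nodes) (l : ℕ) (hl : Nat.card (C × N) ≤ l) :
    Player1Wins l (l + 1) S T (z 0) (z n) ∨
      ∃ H : ℕ → N, (∀ i p q, p < q → q ≤ n → E i p q → T.edge i (H p) (H q)) ∧
        H 0 ∈ T.source ∧ H n ∈ T.target := by
  classical
  have := Fintype.ofFinite C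
  have := Fintype.ofFinite N
  refine or_iff_not_imp_right.2 fun hno => ?_
  -- Induction on the number `m` of positions still to visit. `H` records all images seen so far,
  -- although only the positions in `B` are still pebbled; every visited position that is a node of
  -- `S` has a representative in `B` with the same class and image.
  have key : ∀ m j, j + m = n + 1 → ∀ (B : Finset ℕ) (H : ℕ → N) (A : Finset U) (h : A → N),
      B ⊆ Finset.range j → B.card ≤ l → (∀ b ∈ B, z b ∈ S.nodes) →
      (∀ b ∈ B, ∃ hb : z b ∈ A, h ⟨z b, hb⟩ = H b) →
      (∀ p < j, z p ∈ S.nodes → ∃ b ∈ B, cls p j = cls b j ∧ H p = H b) →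
      (∀ i p q, p < q → q < j → E i p q → T.edge i (H p) (H q)) →
      (0 < j → H 0 ∈ T.source) → (n < j → H n ∈ T.target) →
      Player1WinsFrom l (l + 1) S T (z 0) (z n) A h := by
    intro m
    induction m with
    | zero =>
      intro j hj B H A h _ _ _ _ _ hHe hHs hHt
      exact absurd ⟨H, fun i p q hpq hq => hHe i p q hpq (by omega), hHs (by omega),
        hHt (by omega)⟩ hno
    | succ m ih =>
      intro j hj B H A h hBj hBl hBS hBA hrep hHe hHs hHt
      by_cases hz : z j ∈ S.nodes
      swap
      -- A position whose node is outside `S` cannot be pebbled; it is in no fact, so its image is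
      -- irrelevant. The end positions are in `S` and are never skipped.
      · refine ih (j + 1) (by omega) B H A h
          (hBj.trans (Finset.range_subset_range.2 (by omega))) hBl hBS hBA ?_ ?_ ?_ ?_
        · intro p hp hpS
          have hpj : p < j := lt_of_le_of_ne (by omega) (by rintro rfl; exact hz hpS)
          obtain ⟨b, hb, h1, h2⟩ := hrep p hpj hpS
          exact ⟨b, hb, hcls _ _ _ hpj.le (Finset.mem_range.1 (hBj hb)).le h1, h2⟩
        · intro i p q hpq hq e
          by_cases hqj : q = j
          · subst hqj
            exact absurd (S.right_mem (hE i p q hpq (by omega) e)) hz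
          · exact hHe i p q hpq (by omega) e
        · intro _
          refine hHs (Nat.pos_of_ne_zero ?_)
          rintro rfl
          exact hz h0
        · intro _
          refine hHt (lt_of_le_of_ne (by omega) ?_)
          rintro rfl
          exact hz hn
      · have hA₁ : B.image z ⊆ S.nodes := Finset.image_subset_iff.2 hBS
        have hA₁l : (B.image z).card ≤ l := Finset.card_image_le.trans hBl
        -- This move only discards pebbles. Since `z` need not be injective, `A` may already contain
        -- `z j`, and a direct move could share `l + 1` nodes with it.
        refine .move (B.image z) hA₁ (by omega)
          ((Finset.card_le_card Finset.inter_subset_right).trans hA₁l) fun h₁ hh₁ hext₁ => ?_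
        have hA₂ : insert (z j) (B.image z) ⊆ S.nodes := Finset.insert_subset hz hA₁
        refine .move (insert (z j) (B.image z)) hA₂
          ((Finset.card_insert_le _ _).trans (by omega))
          ((Finset.card_le_card Finset.inter_subset_left).trans hA₁l) fun h₂ hh₂ hext₂ => ?_
        have hzj : z j ∈ insert (z j) (B.image z) := Finset.mem_insert_self _ _
        set H' : ℕ → N := Function.update H j (h₂ ⟨z j, hzj⟩) with hH'
        have hH'j : H' j = h₂ ⟨z j, hzj⟩ := Function.update_self _ _ _
        have hH'p : ∀ p, p ≠ j → H' p = H p := fun p hp => Function.update_of_ne hp _ _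
        have hB₂ : ∀ b ∈ insert j B, ∃ hb : z b ∈ insert (z j) (B.image z),
            h₂ ⟨z b, hb⟩ = H' b := by
          intro b hb
          rcases Finset.mem_insert.1 hb with rfl | hbB
          · exact ⟨hzj, hH'j.symm⟩
          · have hb₁ : z b ∈ B.image z := Finset.mem_image_of_mem z hbB
            have hbne : b ≠ j := (Finset.mem_range.1 (hBj hbB)).ne
            obtain ⟨hbA, hbH⟩ := hBA b hbB
            refine ⟨Finset.mem_insert_of_mem hb₁, ?_⟩
            rw [hext₂ _ hb₁, hext₁ _ hbA, hbH, hH'p b hbne]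
        have hrep' : ∀ p < j + 1, z p ∈ S.nodes →
            ∃ b ∈ insert j B, cls p (j + 1) = cls b (j + 1) ∧ H' p = H' b := by
          intro p hp hpS
          by_cases hpj : p = j
          · exact ⟨p, hpj ▸ Finset.mem_insert_self _ _, rfl, rfl⟩
          · obtain ⟨b, hb, h1, h2⟩ := hrep p (by omega) hpS
            have hbj := Finset.mem_range.1 (hBj hb)
            refine ⟨b, Finset.mem_insert_of_mem hb, hcls _ _ _ (by omega) hbj.le h1, ?_⟩
            rw [hH'p p hpj, hH'p b hbj.ne, h2]
        -- Keep one position for each pair of class and image; there are at most `Nat.card (C × N) ≤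
        -- l` pairs.
        obtain ⟨B', hB'sub, hB'inj, hB'im⟩ := Finset.exists_subset_injOn_image_eq_of_surjOn
          ((insert j B : Finset ℕ) : Set ℕ) ((insert j B).image fun b => (cls b (j + 1), H' b))
          (f := fun b => (cls b (j + 1), H' b))
          (by rw [Finset.coe_image]; exact Set.surjOn_image _ _)
        rw [Finset.coe_subset] at hB'sub
        refine ih (j + 1) (by omega) B' H' _ h₂ (hB'sub.trans ?_) ?_ ?_ ?_ ?_ ?_ ?_ ?_
        · refine Finset.insert_subset (by simp) (hBj.trans (Finset.range_subset_range.2 (by omega)))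
        · rw [← Finset.card_image_of_injOn hB'inj]
          refine (Finset.card_le_univ _).trans ?_
          rwa [← Nat.card_eq_fintype_card]
        · intro b hb
          rcases Finset.mem_insert.1 (hB'sub hb) with rfl | hb
          exacts [hz, hBS b hb]
        · exact fun b hb => hB₂ b (hB'sub hb)
        · intro p hp hpS
          obtain ⟨b, hb, h1, h2⟩ := hrep' p hp hpS
          have := Finset.mem_image_of_mem (fun b => (cls b (j + 1), H' b)) hb
          rw [← hB'im] at this
          obtain ⟨b', hb', he⟩ := Finset.mem_image.1 this
          obtain ⟨he1, he2⟩ := Prod.mk.inj he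
          exact ⟨b', hb', h1.trans he1.symm, h2.trans he2.symm⟩
        · intro i p q hpq hq e
          by_cases hqj : q = j
          · subst hqj
            -- The pebble on `p` may be gone. Its representative `b` has the same class, so it has
            -- the same fact with `q`, and the same image; Player 2's answer respects the fact at
            -- `b`.
            have hpS : z p ∈ S.nodes := S.left_mem (hE i p q hpq (by omega) e)
            obtain ⟨b, hb, h1, h2⟩ := hrep p hpq hpS
            have hbq := Finset.mem_range.1 (hBj hb)
            have hedge := hE i b q hbq (by omega) (hEc i p b q hpq hbq h1 e)
            obtain ⟨hb', hbH⟩ := hB₂ b (Finset.mem_insert_of_mem hb)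
            have := hh₂.1 i ⟨z b, hb'⟩ ⟨z q, hzj⟩ hedge
            rwa [hbH, ← hH'j, hH'p b hbq.ne, ← h2, ← hH'p p hpq.ne] at this
          · rw [hH'p p (by omega), hH'p q hqj]
            exact hHe i p q hpq (by omega) e
        · intro _
          by_cases hj0 : j = 0
          · subst hj0
            rw [hH'j]
            exact hh₂.2.1 _ rfl
          · rw [hH'p 0 (Ne.symm hj0)]
            exact hHs (Nat.pos_of_ne_zero hj0)
        · intro _
          by_cases hjn : j = n
          · subst hjn
            rw [hH'j]
            exact hh₂.2.2 _ rfl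
          · rw [hH'p n (Ne.symm hjn)]
            exact hHt (by omega)
  exact key (n + 1) 0 (by omega) ∅ (fun _ => Classical.arbitrary N) ∅ _ (by simp) (by simp)
    (by simp) (by simp) (by simp) (by simp) (by simp) (by simp)

/-- The factor of a word between two positions. -/
def factor (w : List σ) (p q : ℕ) : List σ := (w.take q).drop p

theorem factor_succ (w : List σ) {p q : ℕ} (h : p ≤ q) :
    factor w p (q + 1) = factor w p q ++ w[q]?.toList := by
  rw [factor, factor, List.take_add_one]
  by_cases hq : q ≤ w.length
  · rw [List.drop_append_of_le_length (by simp [h, hq])]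
  · rw [List.getElem?_eq_none (by omega)]
    simp

theorem factor_self (w : List σ) (p : ℕ) : factor w p p = [] := by
  simp [factor]

theorem factor_length (w : List σ) : factor w 0 w.length = w := by simp [factor]

theorem GraphDB.path_factor {D : GraphDB σ U} {w : List σ} {z : ℕ → U}
    (hz : ∀ p, ∀ a ∈ w[p]?, D.edge a (z p) (z (p + 1))) (hn : ∀ p ≤ w.length, z p ∈ D.nodes)
    {p q : ℕ} (hpq : p ≤ q) (hq : q ≤ w.length) : D.Path (z p) (factor w p q) (z q) := by
  induction q, hpq using Nat.le_induction with
  | base =>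
    rw [factor_self]
    exact .nil (hn p hq)
  | succ q hpq ih =>
    rw [factor_succ _ hpq]
    refine (ih (by omega)).append ?_
    have := hz q w[q] (by simp)
    rw [List.getElem?_eq_getElem (by omega)]
    exact .cons this (.nil (hn _ hq))

theorem GraphDB.Path.exists_positions {D : GraphDB σ U} {x y : U} {w : List σ}
    (p : D.Path x w y) : ∃ z : ℕ → U, z 0 = x ∧ z w.length = y ∧
      (∀ p, ∀ a ∈ w[p]?, D.edge a (z p) (z (p + 1))) ∧ ∀ p ≤ w.length, z p ∈ D.nodes := by
  induction p with
  | @nil x hx => exact ⟨fun _ => x, rfl, rfl, by simp, fun _ _ => hx⟩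
  | @cons x y t a w h p ih =>
    obtain ⟨z, h0, h1, h2, h3⟩ := ih
    refine ⟨fun | 0 => x | p + 1 => z p, rfl, h1, ?_, ?_⟩
    · rintro (_ | p) b hb
      · obtain rfl : a = b := by simpa using hb
        change D.edge a x (z 0)
        rwa [h0]
      · exact h2 p b (by simpa using hb)
    · rintro (_ | p) hp
      · exact D.left_mem h
      · exact h3 p (by simpa using hp)

/-- The database formed by a simple path with label `w` along the nodes `f 0, f 1, …`. -/
def pathDB (w : List σ) (f : ℕ ↪ U) : GraphDB σ U where
  nodes := (Finset.range (w.length + 1)).map f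
  edge a x y := ∃ p, w[p]? = some a ∧ x = f p ∧ y = f (p + 1)
  left_mem := by
    rintro a x y ⟨p, hp, rfl, rfl⟩
    obtain ⟨h, -⟩ := List.getElem?_eq_some_iff.1 hp
    exact Finset.mem_map_of_mem _ (Finset.mem_range.2 (by omega))
  right_mem := by
    rintro a x y ⟨p, hp, rfl, rfl⟩
    obtain ⟨h, -⟩ := List.getElem?_eq_some_iff.1 hp
    exact Finset.mem_map_of_mem _ (Finset.mem_range.2 (by omega))

/-- As `f` is injective, each edge leads to the next position and no other move is possible. -/
theorem pathDB_path {w : List σ} {f : ℕ ↪ U} {x y : U} {v : List σ}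
    (h : (pathDB w f).Path x v y) :
    ∃ p q, p ≤ q ∧ q ≤ w.length ∧ x = f p ∧ y = f q ∧ v = factor w p q := by
  induction h with
  | nil hx =>
    obtain ⟨p, hp, rfl⟩ := Finset.mem_map.1 hx
    exact ⟨p, p, le_rfl, Nat.lt_succ_iff.1 (Finset.mem_range.1 hp), rfl, rfl,
      (factor_self w p).symm⟩
  | @cons x y t a v h _ ih =>
    obtain ⟨p, hp, rfl, rfl⟩ := h
    obtain ⟨p', q, hpq, hq, h1, rfl, rfl⟩ := ih
    obtain rfl := f.injective h1
    obtain ⟨hlt, ha⟩ := List.getElem?_eq_some_iff.1 hp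
    refine ⟨p, q, by omega, hq, rfl, rfl, ?_⟩
    rw [factor, factor, List.drop_eq_getElem_cons (i := p) (by simp; omega)]
    simp [ha]

/-- If `V` determines `Q` in a monotone way, then Player 1 wins the game on the view instance for
the answers of `Q`, provided that he has enough pebbles. -/
theorem DeterminesMonotonically.player1Wins [Infinite U] [Finite τ]
    {V : τ → RegularExpression σ} {Q : RegularExpression σ} (hV : ∀ i, [] ∉ (V i).matches')
    (hVQ : DeterminesMonotonically U V Q) {D : GraphDB σ U} {u v : U}
    (huv : (u, v) ∈ rpqAnswer Q D) {l : ℕ}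
    (hl : Nat.card ((∀ i, Set.range (V i).matches'.leftQuotient) ×
      Set (Set.range Q.matches'.leftQuotient)) ≤ l) :
    Player1Wins l (l + 1) (viewInstance V D) (templateQV Q V) u v := by
  have hmem := hVQ.1.mem_nodes huv
  obtain ⟨w, hw, path⟩ := huv
  obtain ⟨z, rfl, rfl, hz, hzn⟩ := path.exists_positions
  have : ∀ i, Finite (Set.range (V i).matches'.leftQuotient) :=
    fun i => (V i).finite_range_leftQuotient.to_subtype
  have : Finite (Set.range Q.matches'.leftQuotient) := Q.finite_range_leftQuotient.to_subtype
  -- The class of `p` seen from `q` is the family of left quotients by the factor between them. It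
  -- determines the class after one more letter, and it determines whether the factor is in
  -- `L(V_i)`: this holds iff the quotient contains the empty word.
  refine (player1Wins_or_exists_map (viewInstance V D) (templateQV Q V) w.length z
    (fun p q i => (⟨(V i).matches'.leftQuotient (factor w p q), factor w p q, rfl⟩ :
      Set.range (V i).matches'.leftQuotient))
    (fun i p q => factor w p q ∈ (V i).matches') ?_ ?_ ?_ hmem.1 hmem.2 l hl).resolve_right ?_
  · exact fun i p q hpq hq h => ⟨_, h, GraphDB.path_factor hz hzn hpq.le hq⟩
  · intro p p' q hp hp' h
    funext i
    have hi := congrArg Subtype.val (congrFun h i)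
    refine Subtype.ext ?_
    simp only at hi ⊢
    rw [factor_succ _ hp, factor_succ _ hp', Language.leftQuotient_append, hi,
      Language.leftQuotient_append]
  · intro i p p' q _ _ h hE
    have hi := congrArg Subtype.val (congrFun h i)
    simp only at hi
    have h1 : ([] : List σ) ∈ (V i).matches'.leftQuotient (factor w p q) := by
      rw [Language.mem_leftQuotient, List.append_nil]; exact hE
    rw [hi, Language.mem_leftQuotient, List.append_nil] at h1
    exact h1
  · rintro ⟨H, hH, hs, ht⟩
    -- A map `H` on positions is a homomorphism on the view instance of a simple path labelled `w`,
    -- where positions are distinct nodes. Its facts join `p < q`, strictly since no view language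
    -- contains the empty word.
    let f := Infinite.natEmbedding U
    have hans : (f 0, f w.length) ∈ rpqAnswer Q (pathDB w f) := by
      refine ⟨w, hw, ?_⟩
      have := GraphDB.path_factor (D := pathDB w f) (w := w) (z := f)
        (fun p a ha => ⟨p, ha, rfl, rfl⟩)
        (fun p hp => Finset.mem_map_of_mem _ (Finset.mem_range.2 (by omega))) (Nat.zero_le _) le_rfl
      rwa [factor_length] at this
    have hinv : ∀ p, Function.invFun f (f p) = p := Function.leftInverse_invFun f.injective
    refine hVQ.not_isTemplateHom hV hans (fun x => H (Function.invFun f x)) ⟨?_, ?_, ?_⟩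
    · rintro i x y ⟨v, hv, path⟩
      obtain ⟨p, q, hpq, hq, rfl, rfl, rfl⟩ := pathDB_path path
      rw [hinv, hinv]
      refine hH i p q (lt_of_le_of_ne hpq ?_) hq hv
      rintro rfl
      rw [factor_self] at hv
      exact hV i hv
    · rwa [hinv]
    · rwa [hinv]

end Sweep

/-! ### Finitely many rules with boundedly many variables. -/

section BoundedRules

variable {τ : Type*} {n : ℕ} {arity : Fin n → ℕ}

/-- Atoms with variables among `0, …, k - 1`. -/
abbrev BoundedAtom (τ : Type*) {n : ℕ} (arity : Fin n → ℕ) (k : ℕ) :=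
  (τ × Fin k × Fin k) ⊕ (Σ I : Fin n, Fin (arity I) → Fin k)

/-- The underlying atom. -/
def BoundedAtom.toAtom {k : ℕ} : BoundedAtom τ arity k → DatalogAtom τ arity
  | .inl (i, x, y) => .schema i x y
  | .inr ⟨I, args⟩ => .internal I fun j => args j

theorem mem_bodyVars {body : List (DatalogAtom τ arity)} {x : ℕ} :
    x ∈ bodyVars body ↔ ∃ a ∈ body, x ∈ a.vars := by
  induction body with
  | nil => simp [bodyVars]
  | cons a body ih =>
    have : bodyVars (a :: body) = a.vars ∪ bodyVars body := rfl
    simp [this, ih]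

theorem BoundedAtom.vars_subset {k : ℕ} (b : BoundedAtom τ arity k) :
    b.toAtom.vars ⊆ Finset.range k := by
  intro x hx
  rcases b with ⟨i, y, z⟩ | ⟨I, args⟩
  · rcases Finset.mem_insert.1 hx with rfl | hx
    · simp
    · rw [Finset.mem_singleton.1 hx]; simp
  · obtain ⟨j, -, rfl⟩ := Finset.mem_image.1 hx
    simp

/-- The rules with at most `k` variables that satisfy a given property form, up to renaming of the
variables and reordering of the bodies, a finite list. -/
theorem exists_rules [Finite τ] (arity : Fin n → ℕ) (k : ℕ) (Good : DatalogRule τ arity → Prop) :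
    ∃ rules : List (DatalogRule τ arity),
      (∀ r ∈ rules, Good r ∧ (bodyVars r.body).card ≤ k) ∧
      ∀ (I : Fin n) (args : Fin (arity I) → Fin k) (B : Set (BoundedAtom τ arity k)),
        ∃ body : List (DatalogAtom τ arity), (∀ a, a ∈ body ↔ ∃ b ∈ B, b.toAtom = a) ∧
          ∀ safe, Good ⟨I, fun j => args j, body, safe⟩ →
            (⟨I, fun j => args j, body, safe⟩ : DatalogRule τ arity) ∈ rules := by
  classical
  -- Bodies are lists, so there are infinitely many rules; fixing one enumeration of each set of
  -- bounded atoms leaves finitely many.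
  let body : Set (BoundedAtom τ arity k) → List (DatalogAtom τ arity) :=
    fun B => B.toFinite.toFinset.toList.map BoundedAtom.toAtom
  have hbody : ∀ B a, a ∈ body B ↔ ∃ b ∈ B, b.toAtom = a := by
    intro B a
    simp [body]
  let X := {x : (Σ I : Fin n, Fin (arity I) → Fin k) × Set (BoundedAtom τ arity k) //
    ∀ j, (x.1.2 j : ℕ) ∈ bodyVars (body x.2)}
  let R : X → DatalogRule τ arity := fun x =>
    ⟨x.1.1.1, fun j => x.1.1.2 j, body x.1.2, x.2⟩
  have hfin : {r | (∃ x, R x = r) ∧ Good r}.Finite :=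
    (Set.finite_range R).subset fun r hr => hr.1
  refine ⟨hfin.toFinset.toList, ?_, ?_⟩
  · intro r hr
    obtain ⟨⟨x, rfl⟩, hg⟩ := hfin.mem_toFinset.1 (Finset.mem_toList.1 hr)
    refine ⟨hg, ?_⟩
    rw [← Finset.card_range k]
    refine Finset.card_le_card fun y hy => ?_
    obtain ⟨a, ha, hya⟩ := mem_bodyVars.1 hy
    obtain ⟨b, -, rfl⟩ := (hbody _ _).1 ha
    exact b.vars_subset hya
  · intro I args B
    refine ⟨body B, hbody B, fun safe hg => ?_⟩
    exact Finset.mem_toList.2 (hfin.mem_toFinset.2 ⟨⟨⟨(⟨I, args⟩, B), safe⟩, rfl⟩, hg⟩)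

end BoundedRules

/-! ### The canonical program of all sound rules. -/

section Canonical

variable {τ U N : Type*} {l : ℕ}

/-- The internal symbols of the canonical program: `none` for the unary relation of all nodes, and
`some ⟨s, b⟩` for the relation of the `(u, v, x₁, …, x_s)` such that Player 1 wins from the
positions where `x` is mapped to `b`. -/
abbrev GameSymbol (N : Type*) (l : ℕ) := Option (Σ s : Fin (l + 1), Fin s → N)

/-- The arity of the symbols. -/
def GameSymbol.arity : GameSymbol N l → ℕ
  | none => 1
  | some b => b.1 + 2

/-- The tuple `(u, v, x₁, …, x_s)`. -/
def gameArgs {α : Type*} {s : ℕ} (u v : α) (x : Fin s → α) : Fin (s + 2) → α :=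
  Fin.cons u (Fin.cons v x)

theorem comp_gameArgs {α β : Type*} {s : ℕ} (f : α → β) (u v : α) (x : Fin s → α) :
    f ∘ gameArgs u v x = gameArgs (f u) (f v) (f ∘ x) := by
  funext j
  refine Fin.cases rfl (fun j => ?_) j
  exact Fin.cases rfl (fun j => rfl) j

/-- The intended meaning of the symbols. -/
def GameSymbol.Meaning (S : GraphDB τ U) (T : Template τ N) :
    (K : GameSymbol N l) → (Fin K.arity → U) → Prop
  | none, a => ∀ j, a j ∈ S.nodes
  | some ⟨s, b⟩, (a : Fin (s + 2) → U) => (∀ j, a j ∈ S.nodes) ∧ ∀ (A : Finset U) (h : A → N),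
      (∀ j : Fin s, ∃ hj : a j.succ.succ ∈ A, h ⟨a j.succ.succ, hj⟩ = b j) →
        Player1WinsFrom l (l + 1) S T (a 0) (a 1) A h

/-- A rule that is correct for the intended meaning of the symbols. -/
def GameSymbol.Sound {n : ℕ} (U : Type*) (T : Template τ N) (e : Fin n ≃ GameSymbol N l)
    (r : DatalogRule τ fun I => (e I).arity) : Prop :=
  ∀ (S : GraphDB τ U) (ν : ℕ → U),
    (∀ i x y, DatalogAtom.schema i x y ∈ r.body → S.edge i (ν x) (ν y)) →
    (∀ I args, DatalogAtom.internal I args ∈ r.body →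
      GameSymbol.Meaning S T (e I) fun j => ν (args j)) →
    GameSymbol.Meaning S T (e r.head) fun j => ν (r.headArgs j)

/-- A program over the symbols of the game. -/
def gameQuery {n : ℕ} (e : Fin n ≃ GameSymbol N l)
    (rules : List (DatalogRule τ fun I => (e I).arity)) : DatalogQuery τ where
  numInternal := n
  arity I := (e I).arity
  rules := rules
  goal := e.symm (some ⟨⟨0, Nat.succ_pos l⟩, Fin.elim0⟩)
  goal_arity := by rw [Equiv.apply_symm_apply]; rfl

/-- The fact with symbol `K` and arguments `a` is derived. -/
def gameHolds {n : ℕ} (e : Fin n ≃ GameSymbol N l)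
    (rules : List (DatalogRule τ fun I => (e I).arity)) (S : GraphDB τ U) (K : GameSymbol N l)
    (a : Fin K.arity → U) : Prop :=
  ∀ (I : Fin n) (hI : e I = K),
    (gameQuery e rules).Derives S I fun j => a (Fin.cast (congrArg GameSymbol.arity hI) j)

variable {n : ℕ} {e : Fin n ≃ GameSymbol N l} {rules : List (DatalogRule τ fun I => (e I).arity)}
  {T : Template τ N}

theorem gameHolds_apply {S : GraphDB τ U} {I : Fin n} {a : Fin (e I).arity → U} :
    gameHolds e rules S (e I) a ↔ (gameQuery e rules).Derives S I a := by
  constructor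
  · exact fun h => h I rfl
  · intro h J hJ
    obtain rfl := e.injective hJ
    exact h

theorem meaning_of_derives (hrules : ∀ r ∈ rules, GameSymbol.Sound U T e r) {S : GraphDB τ U}
    {I : Fin (gameQuery e rules).numInternal} {a : Fin ((gameQuery e rules).arity I) → U}
    (h : (gameQuery e rules).Derives S I a) : GameSymbol.Meaning S T (e I) a := by
  induction h with
  | rule r hr ν hs _ ih => exact hrules r hr S ν hs ih

theorem gameHolds.meaning (hrules : ∀ r ∈ rules, GameSymbol.Sound U T e r) {S : GraphDB τ U}
    {K : GameSymbol N l} {a : Fin K.arity → U} (h : gameHolds e rules S K a) :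
    K.Meaning S T a := by
  obtain ⟨I, rfl⟩ := e.surjective K
  exact meaning_of_derives hrules (gameHolds_apply.1 h)

/-- `rules` contains the sound rules with at most `l + 3` variables. -/
def SoundRulesIn {n : ℕ} (U : Type*) (T : Template τ N) (e : Fin n ≃ GameSymbol N l)
    (rules : List (DatalogRule τ fun I => (e I).arity)) : Prop :=
  ∀ (I : Fin n) (args : Fin (e I).arity → Fin (l + 3))
    (B : Set (BoundedAtom τ (fun I => (e I).arity) (l + 3))),
    ∃ body : List (DatalogAtom τ fun I => (e I).arity), (∀ a, a ∈ body ↔ ∃ b ∈ B, b.toAtom = a) ∧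
      ∀ safe, GameSymbol.Sound U T e ⟨I, fun j => args j, body, safe⟩ →
        (⟨I, fun j => args j, body, safe⟩ : DatalogRule τ fun I => (e I).arity) ∈ rules

/-- A fact is derived if it follows, in every database, from all facts over at most `l + 3` nodes
that are given or derived already. -/
theorem gameHolds_of_sound (hall : SoundRulesIn U T e rules) {S : GraphDB τ U}
    (ν : Fin (l + 3) → U) (K : GameSymbol N l) (args : Fin K.arity → Fin (l + 3))
    (hsafe : ∀ j, (∃ i b, S.edge i (ν (args j)) (ν b) ∨ S.edge i (ν b) (ν (args j))) ∨
      gameHolds e rules S none fun _ => ν (args j))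
    (hsound : ∀ (S' : GraphDB τ U) (ν' : Fin (l + 3) → U),
      (∀ i a b, S.edge i (ν a) (ν b) → S'.edge i (ν' a) (ν' b)) →
      (∀ (K' : GameSymbol N l) (args' : Fin K'.arity → Fin (l + 3)),
        gameHolds e rules S K' (ν ∘ args') → K'.Meaning S' T (ν' ∘ args')) →
      K.Meaning S' T (ν' ∘ args)) :
    gameHolds e rules S K (ν ∘ args) := by
  classical
  obtain ⟨I, rfl⟩ := e.surjective K
  rw [gameHolds_apply]
  -- The body is the whole diagram of `ν`: all given and all derivable facts over its nodes.
  let B : Set (BoundedAtom τ (fun I => (e I).arity) (l + 3)) :=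
    {b | match b with
      | .inl (i, x, y) => S.edge i (ν x) (ν y)
      | .inr ⟨J, a⟩ => gameHolds e rules S (e J) (ν ∘ a)}
  obtain ⟨body, hbody, hmem⟩ := hall I args B
  have hs : ∀ i x y, DatalogAtom.schema i x y ∈ body →
      ∃ x' y' : Fin (l + 3), x = x' ∧ y = y' ∧ S.edge i (ν x') (ν y') := by
    intro i x y h
    obtain ⟨⟨i', x', y'⟩ | ⟨J, a⟩, hb, he⟩ := (hbody _).1 h
    · cases he
      exact ⟨x', y', rfl, rfl, hb⟩
    · cases he
  have hi : ∀ J a, DatalogAtom.internal J a ∈ body →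
      ∃ a' : Fin (e J).arity → Fin (l + 3), a = (fun j => (a' j : ℕ)) ∧
        gameHolds e rules S (e J) (ν ∘ a') := by
    intro J a h
    obtain ⟨⟨i', x', y'⟩ | ⟨J, a'⟩, hb, he⟩ := (hbody _).1 h
    · cases he
    · cases he
      exact ⟨a', rfl, hb⟩
  have hsafe' : ∀ j, (args j : ℕ) ∈ bodyVars body := by
    intro j
    rw [mem_bodyVars]
    rcases hsafe j with ⟨i, b, h | h⟩ | h
    · exact ⟨.schema i (args j) b, (hbody _).2 ⟨.inl (i, args j, b), h, rfl⟩,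
        by simp [DatalogAtom.vars]⟩
    · exact ⟨.schema i b (args j), (hbody _).2 ⟨.inl (i, b, args j), h, rfl⟩,
        by simp [DatalogAtom.vars]⟩
    · obtain ⟨J, hJ⟩ := e.surjective none
      refine ⟨.internal J fun _ => args j, (hbody _).2 ⟨.inr ⟨J, fun _ => args j⟩, ?_, rfl⟩, ?_⟩
      · exact gameHolds_apply.2 (h J hJ)
      · have hpos : 0 < (e J).arity := by rw [hJ]; exact Nat.one_pos
        exact Finset.mem_image.2 ⟨⟨0, hpos⟩, Finset.mem_univ _, rfl⟩
  have hr := hmem hsafe' (by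
    intro S' ν' h1 h2
    refine hsound S' (fun a => ν' a) (fun i a b h => ?_) (fun K' args' h => ?_)
    · exact h1 i a b ((hbody _).2 ⟨.inl (i, a, b), h, rfl⟩)
    · obtain ⟨J, rfl⟩ := e.surjective K'
      exact h2 J (fun j => args' j) ((hbody _).2 ⟨.inr ⟨J, args'⟩, h, rfl⟩))
  -- Variables from `l + 3` on do not occur in the rule; their value is arbitrary.
  let ν₀ : ℕ → U := fun x => if hx : x < l + 3 then ν ⟨x, hx⟩ else ν 0
  have hν₀ : ∀ x : Fin (l + 3), ν₀ x = ν x := fun x => by simp [ν₀]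
  have := DatalogQuery.Derives.rule (P := gameQuery e rules) (S := S) _ hr ν₀ (by
    intro i x y h
    obtain ⟨x', y', rfl, rfl, h⟩ := hs i x y h
    rwa [hν₀, hν₀]) (by
    intro J a h
    obtain ⟨a', rfl, ha'⟩ := hi J a h
    simp only [hν₀]
    exact gameHolds_apply.1 ha')
  simp only [hν₀] at this
  exact this

/-- The unary facts make the other rules safe and keep their variables inside the nodes of the
database. They are derived from an incident edge, which is why isolated nodes are excluded. -/
theorem gameHolds_node (hall : SoundRulesIn U T e rules) {S : GraphDB τ U} {x : U}
    (hx : S.Active x) : gameHolds e rules S none fun _ => x := by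
  obtain ⟨i, y, h⟩ := hx
  let ν : Fin (l + 3) → U := fun a => if a = 0 then x else y
  have h0 : ν 0 = x := if_pos rfl
  have h1 : ν 1 = y := if_neg (by simp)
  have := gameHolds_of_sound hall (S := S) ν none (fun _ => 0)
    (fun _ => .inl ⟨i, 1, by rwa [h0, h1]⟩) (by
      intro S' ν' hS' _ j
      rcases h with h | h
      · exact S'.left_mem (hS' i 0 1 (by rwa [h0, h1]))
      · exact S'.right_mem (hS' i 1 0 (by rwa [h0, h1])))
  simpa [Function.comp_def, h0] using this

/-- Names the nodes of `W` by variables: `c` chooses the variable and `ν` is the valuation. -/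
theorem exists_section {W : Finset U} {k : ℕ} (hW : W.card ≤ k) (hne : W.Nonempty) :
    ∃ (ν : Fin k → U) (c : U → Fin k), ∀ w ∈ W, ν (c w) = w := by
  classical
  obtain ⟨f⟩ : Nonempty (W ↪ Fin k) :=
    Function.Embedding.nonempty_of_card_le (by simpa using hW)
  have : Nonempty W := hne.to_subtype
  obtain ⟨w₀, hw₀⟩ := hne
  refine ⟨fun a => (Function.invFun (f : W → Fin k) a : W), fun w => if h : w ∈ W then f ⟨w, h⟩ else f ⟨w₀, hw₀⟩,
    fun w hw => ?_⟩
  simp only [dif_pos hw]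
  rw [Function.leftInverse_invFun f.injective]

/-- If Player 1 wins from a position, this is derived for some subtuple of it. -/
theorem gameHolds_of_player1WinsFrom (hall : SoundRulesIn U T e rules) {S : GraphDB τ U}
    (hS : S.NoIsolated) {u v : U} (hu : u ∈ S.nodes) (hv : v ∈ S.nodes) {A : Finset U} {h : A → N}
    (hA : A ⊆ S.nodes) (hw : Player1WinsFrom l (l + 1) S T u v A h) :
    ∃ (s : Fin (l + 1)) (x : Fin s → U) (hx : ∀ j, x j ∈ A),
      gameHolds e rules S (some ⟨s, fun j => h ⟨x j, hx j⟩⟩) (gameArgs u v x) := by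
  classical
  induction hw with
  | @move A h A' hA' hk hl _ ih =>
    -- The rule for a move mentions `u`, `v` and the at most `l + 1` nodes of `A'`.
    obtain ⟨ν, c, hνc⟩ := exists_section (W := insert u (insert v A')) (k := l + 3)
      (by have := Finset.card_insert_le u (insert v A')
          have := Finset.card_insert_le v A'
          omega) ⟨u, Finset.mem_insert_self _ _⟩
    have hcu : ν (c u) = u := hνc u (by simp)
    have hcv : ν (c v) = v := hνc v (by simp)
    have hcA : ∀ w ∈ A', ν (c w) = w := fun w hw => hνc w (by simp [hw])
    -- After the move to `A'` only the values of `h` on `A ∩ A'` matter, so a tuple of at most `l`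
    -- nodes is enough.
    let s : Fin (l + 1) := ⟨(A ∩ A').card, Nat.lt_succ_of_le hl⟩
    let x : Fin s → U := fun j => ((A ∩ A').equivFin.symm j : U)
    have hx : ∀ j, x j ∈ A ∩ A' := fun j => ((A ∩ A').equivFin.symm j).2
    have hxA : ∀ j, x j ∈ A := fun j => Finset.mem_of_mem_inter_left (hx j)
    have hxA' : ∀ j, x j ∈ A' := fun j => Finset.mem_of_mem_inter_right (hx j)
    have hxs : ∀ w ∈ A ∩ A', ∃ j, x j = w := fun w hw =>
      ⟨(A ∩ A').equivFin ⟨w, hw⟩, by simp [x]⟩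
    refine ⟨s, x, hxA, ?_⟩
    have hargs : ∀ {r : ℕ} {y : Fin r → U}, (∀ j, y j ∈ A') →
        ν ∘ gameArgs (c u) (c v) (c ∘ y) = gameArgs u v y := by
      intro r y hy
      rw [comp_gameArgs, hcu, hcv]
      congr 1
      funext j
      exact hcA _ (hy j)
    have hnodes : ∀ j, gameArgs u v x j ∈ S.nodes := by
      intro j
      refine Fin.cases hu (fun j => ?_) j
      exact Fin.cases hv (fun j => hA (hxA j)) j
    have hnode : ∀ j, gameHolds e rules S none fun _ => ν (gameArgs (c u) (c v) (c ∘ x) j) := by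
      intro j
      have := congrFun (hargs hxA') j
      rw [Function.comp_apply] at this
      rw [this]
      exact gameHolds_node hall (hS _ (hnodes j))
    rw [← hargs hxA']
    refine gameHolds_of_sound hall ν (some ⟨s, _⟩) (gameArgs (c u) (c v) (c ∘ x))
      (fun j => .inr (hnode j)) ?_
    -- Soundness has to hold in every `S'`, under valuations that may identify nodes. There Player 1
    -- copies his move: he drops all but the image of `A ∩ A'`, then selects the image of `A'`.
    intro S' ν' hedge hmean
    have hnodes' : ∀ j, ν' (gameArgs (c u) (c v) (c ∘ x) j) ∈ S'.nodes := fun j =>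
      hmean none (fun _ => gameArgs (c u) (c v) (c ∘ x) j) (hnode j) ⟨0, Nat.one_pos⟩
    refine ⟨hnodes', fun A₀ h₀ hA₀ => ?_⟩
    have hA₂S : ∀ w ∈ A', ν' (c w) ∈ S'.nodes := by
      intro w hw
      have : gameHolds e rules S none fun _ => ν (c w) := by
        rw [hcA w hw]
        exact gameHolds_node hall (hS _ (hA' hw))
      exact hmean none (fun _ => c w) this ⟨0, Nat.one_pos⟩
    change ∀ j, ∃ hj : ν' (c (x j)) ∈ A₀, h₀ ⟨ν' (c (x j)), hj⟩ = h ⟨x j, hxA j⟩ at hA₀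
    set A₁ : Finset U := Finset.univ.image fun j => ν' (c (x j)) with hA₁def
    have hA₁ : ∀ j, ν' (c (x j)) ∈ A₁ := fun j => Finset.mem_image_of_mem _ (Finset.mem_univ _)
    have hA₁c : A₁.card ≤ l := by
      refine Finset.card_image_le.trans ?_
      rw [Finset.card_univ, Fintype.card_fin]
      exact hl
    refine .move A₁ ?_ (by omega)
      ((Finset.card_le_card Finset.inter_subset_right).trans hA₁c) fun h₁ hh₁ hext₁ => ?_
    · refine Finset.image_subset_iff.2 fun j _ => hA₂S _ (hxA' j)
    refine .move (A'.image fun w => ν' (c w)) (Finset.image_subset_iff.2 hA₂S)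
      (Finset.card_image_le.trans hk)
      ((Finset.card_le_card Finset.inter_subset_left).trans hA₁c) fun h₂ hh₂ hext₂ => ?_
    have hA₂ : ∀ w ∈ A', ν' (c w) ∈ A'.image fun w => ν' (c w) :=
      fun w hw => Finset.mem_image_of_mem _ hw
    -- Pulled back to `A'`, Player 2's answer is an answer in the original game, as `S'` has all
    -- facts of the body. By induction a fact is derived for it; that fact is in the body too, and
    -- its meaning in `S'` is a win from `h₂`.
    obtain ⟨s', x', hx', hholds⟩ := ih (fun w => h₂ ⟨ν' (c w), hA₂ w w.2⟩) (by
        refine ⟨fun i y z hyz => ?_, ?_, ?_⟩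
        · refine hh₂.1 i ⟨_, hA₂ y y.2⟩ ⟨_, hA₂ z z.2⟩ (hedge i _ _ ?_)
          rwa [hcA _ y.2, hcA _ z.2]
        · rintro ⟨y, hy⟩ rfl
          exact hh₂.2.1 ⟨_, hA₂ y hy⟩ rfl
        · rintro ⟨y, hy⟩ rfl
          exact hh₂.2.2 ⟨_, hA₂ y hy⟩ rfl) (by
        intro y hyA hyA'
        obtain ⟨j, rfl⟩ := hxs y (Finset.mem_inter.2 ⟨hyA, hyA'⟩)
        obtain ⟨hj, hj'⟩ := hA₀ j
        rw [← hj', ← hext₁ _ hj (hA₁ j)]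
        exact hext₂ _ (hA₁ j) _) hA'
    rw [← hargs hx'] at hholds
    exact (hmean (some ⟨s', _⟩) (gameArgs (c u) (c v) (c ∘ x')) hholds).2 _ h₂ fun j =>
      ⟨hA₂ _ (hx' j), rfl⟩

/-- Soundness gives one inclusion. For the other, the subtuple derived from the initial empty
position must be empty, which leaves exactly the goal symbol. -/
theorem eval_gameQuery (hrules : ∀ r ∈ rules, GameSymbol.Sound U T e r)
    (hall : SoundRulesIn U T e rules) {S : GraphDB τ U} (hS : S.NoIsolated) :
    (gameQuery e rules).eval S =
      {p | p.1 ∈ S.nodes ∧ p.2 ∈ S.nodes ∧ Player1Wins l (l + 1) S T p.1 p.2} := by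
  ext ⟨u, v⟩
  have hargs : ∀ x : Fin 0 → U, gameArgs u v x = ![u, v] := fun x => by
    funext j
    fin_cases j <;> rfl
  have hgoal : (u, v) ∈ (gameQuery e rules).eval S ↔
      gameHolds e rules S (some ⟨⟨0, Nat.succ_pos l⟩, Fin.elim0⟩) ![u, v] := by
    constructor
    · intro h J hJ
      obtain rfl : J = e.symm (some ⟨⟨0, Nat.succ_pos l⟩, Fin.elim0⟩) := by rw [← hJ, Equiv.symm_apply_apply]
      exact h
    · intro h
      exact h _ (Equiv.apply_symm_apply _ _)
  rw [hgoal]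
  constructor
  · intro h
    obtain ⟨h1, h2⟩ := h.meaning hrules
    exact ⟨h1 (0 : Fin 2), h1 (1 : Fin 2), h2 ∅ _ fun j => j.elim0⟩
  · rintro ⟨hu, hv, hw⟩
    obtain ⟨s, x, hx, h⟩ :=
      gameHolds_of_player1WinsFrom hall hS hu hv (Finset.empty_subset _) hw
    obtain ⟨s, hs⟩ := s
    cases s with
    | zero =>
      have key : ∀ b : Fin 0 → N,
          gameHolds e rules S (some ⟨⟨0, hs⟩, b⟩) (gameArgs u v x) →
          gameHolds e rules S (some ⟨⟨0, hs⟩, Fin.elim0⟩) ![u, v] := by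
        intro b hb
        obtain rfl : b = Fin.elim0 := Subsingleton.elim _ _
        exact hargs x ▸ hb
      exact key _ h
    | succ s => exact (Finset.notMem_empty _ (hx 0)).elim

/-- The canonical Datalog program of a finite template. -/
theorem exists_isCanonical [Finite τ] [Finite N] (U : Type*) (T : Template τ N) (l : ℕ) :
    ∃ P : DatalogQuery τ, P.IsCanonical U l (l + 1) T := by
  obtain ⟨n, ⟨e⟩⟩ := Finite.exists_equiv_fin (GameSymbol N l)
  obtain ⟨rules, h1, h2⟩ := exists_rules (τ := τ) (fun I => (e.symm I).arity) (l + 3)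
    (GameSymbol.Sound U T e.symm)
  refine ⟨gameQuery e.symm rules, ⟨fun I => ?_, fun r hr => (h1 r hr).2⟩, fun S hS =>
    eval_gameQuery (fun r hr => (h1 r hr).1) h2 hS⟩
  change (e.symm I).arity ≤ l + 2
  rcases e.symm I with _ | ⟨s, b⟩
  · change 1 ≤ l + 2
    omega
  · change (s : ℕ) + 2 ≤ l + 2
    omega

end Canonical

/-! ### Naive evaluation of rules on the random access machine. -/

section Ram

/-- Started in `s`, the program `p` halts after at most `T` steps in a state satisfying `Post`. -/
def Runs (p : RamProgram) (s : RamState) (T : ℕ) (Post : RamState → Prop) : Prop :=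
  ∃ t s', RamExec p s t s' ∧ t ≤ T ∧ Post s'

theorem Runs.mono {p : RamProgram} {s : RamState} {T T' : ℕ} {Post Post' : RamState → Prop}
    (h : Runs p s T Post) (hT : T ≤ T') (hP : ∀ s', Post s' → Post' s') : Runs p s T' Post' := by
  obtain ⟨t, s', h1, h2, h3⟩ := h
  exact ⟨t, s', h1, h2.trans hT, hP _ h3⟩

theorem Runs.seq {p q : RamProgram} {s : RamState} {T₁ T₂ : ℕ} {Post : RamState → Prop}
    (h : Runs p s T₁ fun s' => Runs q s' T₂ Post) : Runs (.seq p q) s (T₁ + T₂) Post := by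
  obtain ⟨t, s', h1, h2, t', s'', h3, h4, h5⟩ := h
  exact ⟨_, _, .seq h1 h3, by omega, h5⟩

/-- The loop in which the register `r` takes the values `n - 1, …, 0`, where `n` is the content of
the register `0`; the register `3` has to contain `1`. -/
def RamProgram.loop (r : ℕ) (p : RamProgram) : RamProgram :=
  .seq (.move r 0) (.whileNonzero r (.seq (.sub r r 3) p))

/-- `Inv c` describes the state when the rounds `n - 1, …, c` are done. A round costs `T` plus a
test and a decrement; the final `2` pays for the initialisation and the last test. -/
theorem runs_loop {r : ℕ} {p : RamProgram} {n T : ℕ} (Inv : ℕ → RamState → Prop)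
    (h3 : ∀ c s, Inv c s → s.reg 3 = 1)
    (hbody : ∀ c < n, ∀ s, Inv (c + 1) s → s.reg r = c + 1 →
      Runs p (s.setReg r c) T fun s' => Inv c s' ∧ s'.reg r = c)
    {s : RamState} (hn : s.reg 0 = n) (hs : Inv n (s.setReg r n)) :
    Runs (.loop r p) s (n * (T + 2) + 2) (Inv 0) := by
  have key : ∀ c ≤ n, ∀ s, Inv c s → s.reg r = c →
      Runs (.whileNonzero r (.seq (.sub r r 3) p)) s (c * (T + 2) + 1) (Inv 0) := by
    intro c
    induction c with
    | zero => exact fun _ s hi hr => ⟨1, s, .whileStop hr, by omega, hi⟩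
    | succ c ih =>
      intro hc s hi hr
      obtain ⟨t, s', h1, h2, h4, h5⟩ := hbody c hc s hi hr
      obtain ⟨t', s'', h6, h7, h8⟩ := ih (by omega) s' h4 h5
      have hsub : RamExec (.sub r r 3) s 1 (s.setReg r c) := by
        have := RamExec.sub r r 3 s
        rwa [hr, h3 _ _ hi, Nat.add_sub_cancel] at this
      refine ⟨_, s'', .whileStep (by omega) (.seq hsub h1) h6, ?_, h8⟩
      have : (c + 1) * (T + 2) = c * (T + 2) + (T + 2) := by ring
      omega
  have hmove : RamExec (.move r 0) s 1 (s.setReg r n) := hn ▸ RamExec.move r 0 s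
  obtain ⟨t, s', h1, h2, h4⟩ := key n le_rfl _ hs (Function.update_self _ _ _)
  exact ⟨_, s', .seq hmove h1, by omega, h4⟩

/-- Only the registers `4`, `5`, `6` are changed, and the memory is not. -/
structure Scratch (s s' : RamState) : Prop where
  mem : s'.mem = s.mem
  reg : ∀ r, r ≠ 4 → r ≠ 5 → r ≠ 6 → s'.reg r = s.reg r

theorem Scratch.refl (s : RamState) : Scratch s s := ⟨rfl, fun _ _ _ _ => rfl⟩

theorem Scratch.trans {s s' s'' : RamState} (h : Scratch s s') (h' : Scratch s' s'') :
    Scratch s s'' :=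
  ⟨h'.mem.trans h.mem, fun r h4 h5 h6 => (h'.reg r h4 h5 h6).trans (h.reg r h4 h5 h6)⟩

theorem scratch_setReg (s : RamState) {r : ℕ} (c : ℕ) (hr : r = 4 ∨ r = 5 ∨ r = 6) :
    Scratch s (s.setReg r c) :=
  ⟨rfl, fun r' h4 h5 h6 => Function.update_of_ne (by omega) _ _⟩

theorem setReg_reg_self (s : RamState) (r c : ℕ) : (s.setReg r c).reg r = c :=
  Function.update_self _ _ _

theorem setReg_reg_of_ne (s : RamState) {r r' : ℕ} (c : ℕ) (h : r' ≠ r) :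
    (s.setReg r c).reg r' = s.reg r' :=
  Function.update_of_ne h _ _

/-- Multiplying the register `4` by the register `0`. -/
def mulCode : RamProgram :=
  .seq (.move 5 4) (.seq (.const 4 0) (.loop 6 (.add 4 4 5)))

theorem runs_mulCode {n : ℕ} {s : RamState} (h0 : s.reg 0 = n) (h3 : s.reg 3 = 1) :
    Runs mulCode s (n * 3 + 4) fun s' => Scratch s s' ∧ s'.reg 4 = s.reg 4 * n := by
  let s₁ := s.setReg 5 (s.reg 4)
  let s₂ := s₁.setReg 4 0
  have hs₂ : Scratch s s₂ :=
    (scratch_setReg s _ (by omega)).trans (scratch_setReg s₁ _ (by omega))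
  have hloop := runs_loop (r := 6) (p := .add 4 4 5) (n := n) (T := 1)
    (fun c t => Scratch s t ∧ t.reg 5 = s.reg 4 ∧ t.reg 4 = s.reg 4 * (n - c))
    (fun c t ht => by rw [ht.1.reg 3 (by omega) (by omega) (by omega), h3])
    (by
      rintro c hc t ⟨ht, h5, h4⟩ h6
      refine ⟨1, _, .add 4 4 5 _, le_rfl, ⟨?_, ?_, ?_⟩, ?_⟩
      · exact (ht.trans (scratch_setReg _ _ (by omega))).trans (scratch_setReg _ _ (by omega))
      · rw [setReg_reg_of_ne _ _ (by omega), setReg_reg_of_ne _ _ (by omega), h5]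
      · rw [setReg_reg_self, setReg_reg_of_ne _ _ (by omega), setReg_reg_of_ne _ _ (by omega),
          h4, h5, show n - c = n - (c + 1) + 1 by omega, mul_add, mul_one]
      · rw [setReg_reg_of_ne _ _ (by omega), setReg_reg_self])
    (s := s₂) (by rw [hs₂.reg 0 (by omega) (by omega) (by omega), h0])
    ⟨hs₂.trans (scratch_setReg _ _ (by omega)), rfl, by
      rw [Nat.sub_self, mul_zero]; rfl⟩
  have hrun : Runs mulCode s (1 + (1 + (n * (1 + 2) + 2))) fun s' =>
      Scratch s s' ∧ s'.reg 5 = s.reg 4 ∧ s'.reg 4 = s.reg 4 * (n - 0) :=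
    Runs.seq ⟨1, s₁, .move 5 4 s, le_rfl, Runs.seq ⟨1, s₂, .const 4 0 s₁, le_rfl, hloop⟩⟩
  refine hrun.mono (by omega) ?_
  rintro s' ⟨h1, -, h2⟩
  exact ⟨h1, h2⟩

/-- The number with leading digit `c` and further digits `L` in base `n`. -/
def horner (n c : ℕ) (L : List ℕ) : ℕ := L.foldl (fun a x => a * n + x) c

/-- Computing `horner n c` of the contents of some registers in the register `4`, where `c` is its
previous content. -/
def hornerCode : List ℕ → RamProgram
  | [] => .skip
  | r :: rs => .seq (.seq mulCode (.add 4 4 r)) (hornerCode rs)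

theorem runs_hornerCode (rs : List ℕ) (hrs : ∀ r ∈ rs, r ≠ 4 ∧ r ≠ 5 ∧ r ≠ 6) :
    ∃ b : Polynomial ℕ, ∀ (n : ℕ) (s : RamState), s.reg 0 = n → s.reg 3 = 1 →
      Runs (hornerCode rs) s (b.eval n) fun s' =>
        Scratch s s' ∧ s'.reg 4 = horner n (s.reg 4) (rs.map s.reg) := by
  induction rs with
  | nil =>
    exact ⟨1, fun n s _ _ => ⟨1, s, .skip s, by simp, Scratch.refl s, rfl⟩⟩
  | cons r rs ih =>
    obtain ⟨b, hb⟩ := ih fun r hr => hrs r (List.mem_cons_of_mem _ hr)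
    have hr := hrs r (List.mem_cons_self ..)
    refine ⟨.X * 3 + 5 + b, fun n s h0 h3 => ?_⟩
    have : (Polynomial.X * 3 + 5 + b).eval n = n * 3 + 4 + 1 + b.eval n := by simp
    rw [this]
    refine Runs.seq (Runs.seq ((runs_mulCode h0 h3).mono le_rfl ?_))
    rintro s₁ ⟨hs₁, h4⟩
    refine ⟨1, _, .add 4 4 r s₁, le_rfl, ?_⟩
    set s₂ := s₁.setReg 4 (s₁.reg 4 + s₁.reg r)
    have hs₂ : Scratch s s₂ := hs₁.trans (scratch_setReg _ _ (by omega))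
    refine (hb n s₂ ((hs₂.reg 0 (by omega) (by omega) (by omega)).trans h0)
      ((hs₂.reg 3 (by omega) (by omega) (by omega)).trans h3)).mono le_rfl ?_
    rintro s' ⟨h1, h2⟩
    refine ⟨hs₂.trans h1, h2.trans ?_⟩
    have e1 : s₂.reg 4 = s.reg 4 * n + s.reg r := by
      rw [setReg_reg_self, h4, hs₁.reg r hr.1 hr.2.1 hr.2.2]
    have e2 : rs.map s₂.reg = rs.map s.reg := List.map_congr_left fun r' hr' => by
      have := hrs r' (List.mem_cons_of_mem _ hr')
      exact hs₂.reg r' this.1 this.2.1 this.2.2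
    rw [e1, e2]
    rfl

/-- The address of a fact: the number of its symbol and the registers containing its arguments. -/
abbrev FactCode := ℕ × List ℕ

/-- The address of a fact, for the contents `ρ` of the registers. -/
def FactCode.address (n : ℕ) (ρ : ℕ → ℕ) (a : FactCode) : ℕ := horner n a.1 (a.2.map ρ)

theorem FactCode.address_congr {n : ℕ} {ρ ρ' : ℕ → ℕ} {a : FactCode}
    (h : ∀ r ∈ a.2, ρ r = ρ' r) : a.address n ρ = a.address n ρ' := by
  rw [address, address, List.map_congr_left h]

/-- Computing an address in the register `4`. -/
def FactCode.code (a : FactCode) : RamProgram := .seq (.const 4 a.1) (hornerCode a.2)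

theorem FactCode.runs_code (a : FactCode) (ha : ∀ r ∈ a.2, r ≠ 4 ∧ r ≠ 5 ∧ r ≠ 6) :
    ∃ b : Polynomial ℕ, ∀ (n : ℕ) (s : RamState), s.reg 0 = n → s.reg 3 = 1 →
      Runs a.code s (b.eval n) fun s' => Scratch s s' ∧ s'.reg 4 = a.address n s.reg := by
  obtain ⟨b, hb⟩ := runs_hornerCode a.2 ha
  refine ⟨1 + b, fun n s h0 h3 => ?_⟩
  have : (1 + b).eval n = 1 + b.eval n := by simp
  rw [this]
  refine Runs.seq ⟨1, _, .const 4 a.1 s, le_rfl, ?_⟩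
  have hs₁ : Scratch s (s.setReg 4 a.1) := scratch_setReg _ _ (by omega)
  refine (hb n _ ((hs₁.reg 0 (by omega) (by omega) (by omega)).trans h0)
    ((hs₁.reg 3 (by omega) (by omega) (by omega)).trans h3)).mono le_rfl ?_
  rintro s' ⟨h1, h2⟩
  refine ⟨hs₁.trans h1, h2.trans ?_⟩
  rw [setReg_reg_self]
  exact FactCode.address_congr (a := a) fun r hr => hs₁.reg r (ha r hr).1 (ha r hr).2.1 (ha r hr).2.2

/-- The addresses of the facts that are present in the memory. -/
def RamState.facts (s : RamState) : Set ℕ := {p | s.mem p ≠ 0}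

/-- If all facts in `body` are present, then the fact `head` is added. -/
def ruleCode (head : FactCode) : List FactCode → RamProgram
  | [] => .seq head.code (.store 4 3)
  | a :: body => .seq (.seq a.code (.load 4 4)) (.ifNonzero 4 (ruleCode head body) .skip)

/-- The registers `4`, `5`, `6` and the presence of the fact at the address `p` are changed at
most. -/
structure AddsFact (s : RamState) (p : ℕ) (cond : Prop) (s' : RamState) : Prop where
  reg : ∀ r, r ≠ 4 → r ≠ 5 → r ≠ 6 → s'.reg r = s.reg r
  mem_of_ne : ∀ q, q ≠ p → s'.mem q = s.mem q
  mem_pos : cond → s'.mem p = 1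
  mem_neg : ¬ cond → s'.mem p = s.mem p

theorem runs_ruleCode (head : FactCode) (hhead : ∀ r ∈ head.2, r ≠ 4 ∧ r ≠ 5 ∧ r ≠ 6)
    (body : List FactCode) (hbody : ∀ a ∈ body, ∀ r ∈ a.2, r ≠ 4 ∧ r ≠ 5 ∧ r ≠ 6) :
    ∃ b : Polynomial ℕ, ∀ (n : ℕ) (s : RamState), s.reg 0 = n → s.reg 3 = 1 →
      Runs (ruleCode head body) s (b.eval n)
        (AddsFact s (head.address n s.reg) (∀ a ∈ body, a.address n s.reg ∈ s.facts)) := by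
  induction body with
  | nil =>
    obtain ⟨b, hb⟩ := head.runs_code hhead
    refine ⟨b + 1, fun n s h0 h3 => ?_⟩
    have : (b + 1).eval n = b.eval n + 1 := by simp
    rw [this]
    refine Runs.seq ((hb n s h0 h3).mono le_rfl ?_)
    rintro s₁ ⟨hs₁, h4⟩
    refine ⟨1, _, .store 4 3 s₁, le_rfl, hs₁.reg, fun q hq => ?_, fun _ => ?_,
      fun h => absurd (by simp) h⟩
    · rw [h4, hs₁.mem]
      exact Function.update_of_ne hq _ _
    · rw [h4, hs₁.reg 3 (by omega) (by omega) (by omega), h3]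
      exact Function.update_self _ _ _
  | cons a body ih =>
    obtain ⟨b, hb⟩ := ih fun a ha => hbody a (List.mem_cons_of_mem _ ha)
    have ha := hbody a (List.mem_cons_self ..)
    obtain ⟨b', hb'⟩ := a.runs_code ha
    refine ⟨b' + 1 + (b + 2), fun n s h0 h3 => ?_⟩
    have : (b' + 1 + (b + 2)).eval n = b'.eval n + 1 + (b.eval n + 2) := by simp
    rw [this]
    refine Runs.seq (Runs.seq ((hb' n s h0 h3).mono le_rfl ?_))
    rintro s₁ ⟨hs₁, h4⟩
    refine ⟨1, _, .load 4 4 s₁, le_rfl, ?_⟩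
    rw [h4, hs₁.mem]
    set s₂ := s₁.setReg 4 (s.mem (a.address n s.reg)) with hs₂def
    have hs₂ : Scratch s s₂ := hs₁.trans (scratch_setReg _ _ (by omega))
    have hs₂4 : s₂.reg 4 = s.mem (a.address n s.reg) := setReg_reg_self _ _ _
    by_cases hmem : s.mem (a.address n s.reg) = 0
    · refine ⟨_, s₂, .ifFalse (hs₂4.trans hmem) (.skip _), by omega, hs₂.reg, fun q _ => ?_,
        fun h => ?_, fun _ => ?_⟩
      · rw [hs₂.mem]
      · exact absurd hmem (h a (List.mem_cons_self ..))
      · rw [hs₂.mem]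
    · obtain ⟨t, s', h1, h2, h5⟩ := hb n s₂ ((hs₂.reg 0 (by omega) (by omega) (by omega)).trans h0)
        ((hs₂.reg 3 (by omega) (by omega) (by omega)).trans h3)
      refine ⟨_, s', .ifTrue (by rwa [hs₂4]) h1, by omega, ?_⟩
      have hadd : ∀ a : FactCode, (∀ r ∈ a.2, r ≠ 4 ∧ r ≠ 5 ∧ r ≠ 6) →
          a.address n s₂.reg = a.address n s.reg := fun a ha =>
        FactCode.address_congr fun r hr => hs₂.reg r (ha r hr).1 (ha r hr).2.1 (ha r hr).2.2
      have hcond : (∀ a ∈ body, a.address n s₂.reg ∈ s₂.facts) ↔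
          ∀ c ∈ a :: body, c.address n s.reg ∈ s.facts := by
        have hf : s₂.facts = s.facts := by rw [RamState.facts, hs₂.mem]; rfl
        rw [hf, List.forall_mem_cons]
        refine ⟨fun h => ⟨hmem, fun c hc => ?_⟩, fun h c hc => ?_⟩
        · rw [← hadd c (hbody c (List.mem_cons_of_mem _ hc))]
          exact h c hc
        · rw [hadd c (hbody c (List.mem_cons_of_mem _ hc))]
          exact h.2 c hc
      rw [hadd head hhead, hcond] at h5
      refine ⟨fun r h4 h5' h6 => (h5.reg r h4 h5' h6).trans (hs₂.reg r h4 h5' h6),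
        fun q hq => (h5.mem_of_ne q hq).trans (by rw [hs₂.mem]), h5.mem_pos,
        fun h => (h5.mem_neg h).trans (by rw [hs₂.mem])⟩

/-- A rule about facts: its body and its head. -/
abbrev FactRule := List FactCode × FactCode

/-- Applying some rules, for one valuation of the variables. -/
def rulesCode : List FactRule → RamProgram
  | [] => .skip
  | R :: Rs => .seq (ruleCode R.2 R.1) (rulesCode Rs)

/-- The valuations of the registers by numbers less than `n`: the register `8` contains `0`, and the
registers `9, …, 8 + K` the values of the variables. -/
def IsValuation (n K : ℕ) (ρ : ℕ → ℕ) : Prop := ρ 8 = 0 ∧ ∀ x < K, ρ (9 + x) < n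

/-- All registers used by a rule contain variables or the constant `0`. -/
def FactRule.Bounded (K : ℕ) (R : FactRule) : Prop :=
  (∀ a ∈ R.1, ∀ r ∈ a.2, 8 ≤ r ∧ r < 9 + K) ∧ ∀ r ∈ R.2.2, 8 ≤ r ∧ r < 9 + K

/-- A set of facts is closed under some rules. -/
def FactRule.Closed (n K : ℕ) (Rs : List FactRule) (X : Set ℕ) : Prop :=
  ∀ ρ, IsValuation n K ρ → ∀ R ∈ Rs,
    (∀ a ∈ R.1, FactCode.address n ρ a ∈ X) → FactCode.address n ρ R.2 ∈ X

/-- The invariant of the evaluation: the constants are in place, and the memory contains facts of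
`J` only. -/
structure EvalInv (n u v : ℕ) (J : Set ℕ) (s : RamState) : Prop where
  reg0 : s.reg 0 = n
  reg1 : s.reg 1 = u
  reg2 : s.reg 2 = v
  reg3 : s.reg 3 = 1
  reg8 : s.reg 8 = 0
  mem_le : ∀ p, s.mem p ≤ 1
  facts : s.facts ⊆ J

theorem EvalInv.of_eq {n u v : ℕ} {J : Set ℕ} {s s' : RamState} (h : EvalInv n u v J s)
    (hmem : s'.mem = s.mem) (hreg : ∀ r < 9, r ≠ 4 → r ≠ 5 → r ≠ 6 → s'.reg r = s.reg r) :
    EvalInv n u v J s' := by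
  obtain ⟨h0, h1, h2, h3, h8, hm, hf⟩ := h
  refine ⟨(hreg 0 ?_ ?_ ?_ ?_).trans h0, (hreg 1 ?_ ?_ ?_ ?_).trans h1,
    (hreg 2 ?_ ?_ ?_ ?_).trans h2, (hreg 3 ?_ ?_ ?_ ?_).trans h3, (hreg 8 ?_ ?_ ?_ ?_).trans h8,
    hmem ▸ hm, ?_⟩
  on_goal 21 => rwa [RamState.facts, hmem]
  all_goals omega

theorem EvalInv.setReg {n u v : ℕ} {J : Set ℕ} {s : RamState} (h : EvalInv n u v J s) {r : ℕ}
    (hr : 9 ≤ r) (c : ℕ) : EvalInv n u v J (s.setReg r c) :=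
  h.of_eq rfl fun r' hr' _ _ _ => setReg_reg_of_ne _ _ (by omega)

/-- A fact added by one rule may already fire a later one. So the result is only bracketed: it
contains the consequences of the facts present at the start, and stays inside the closed set `J`. -/
theorem runs_rulesCode {K : ℕ} (Rs : List FactRule) (hRs : ∀ R ∈ Rs, R.Bounded K) :
    ∃ b : Polynomial ℕ, ∀ (n u v : ℕ) (J : Set ℕ), FactRule.Closed n K Rs J → ∀ s : RamState,
      EvalInv n u v J s → (∀ x < K, s.reg (9 + x) < n) →
      Runs (rulesCode Rs) s (b.eval n) fun s' => EvalInv n u v J s' ∧ s.facts ⊆ s'.facts ∧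
        (∀ r, 9 ≤ r → s'.reg r = s.reg r) ∧
        ∀ R ∈ Rs, (∀ a ∈ R.1, FactCode.address n s.reg a ∈ s.facts) →
          FactCode.address n s.reg R.2 ∈ s'.facts := by
  induction Rs with
  | nil =>
    exact ⟨1, fun n u v J _ s hs _ =>
      ⟨1, s, .skip s, by simp, hs, subset_rfl, fun _ _ => rfl, by simp⟩⟩
  | cons R Rs ih =>
    obtain ⟨b, hb⟩ := ih fun R hR => hRs R (List.mem_cons_of_mem _ hR)
    have hne : ∀ {a : FactCode}, (∀ r ∈ a.2, 8 ≤ r ∧ r < 9 + K) →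
        ∀ r ∈ a.2, r ≠ 4 ∧ r ≠ 5 ∧ r ≠ 6 := fun h r hr => by
      have := h r hr
      omega
    have hR := hRs R (List.mem_cons_self ..)
    obtain ⟨b', hb'⟩ := runs_ruleCode R.2 (hne hR.2) R.1 fun a ha => hne (hR.1 a ha)
    refine ⟨b' + b, fun n u v J hJ s hs hval => ?_⟩
    have : (b' + b).eval n = b'.eval n + b.eval n := by simp
    rw [this]
    refine Runs.seq ((hb' n s hs.reg0 hs.reg3).mono le_rfl fun s₁ h₁ => ?_)
    set p := FactCode.address n s.reg R.2
    have hp : (∀ a ∈ R.1, FactCode.address n s.reg a ∈ s.facts) → p ∈ J := fun h =>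
      hJ s.reg ⟨hs.reg8, hval⟩ R (List.mem_cons_self ..) fun a ha => hs.facts (h a ha)
    have hfacts : s.facts ⊆ s₁.facts := by
      intro q hq
      change s₁.mem q ≠ 0
      by_cases hqp : q = p
      · by_cases hc : ∀ a ∈ R.1, FactCode.address n s.reg a ∈ s.facts
        · rw [hqp, h₁.mem_pos hc]
          exact one_ne_zero
        · rw [hqp, h₁.mem_neg hc, ← hqp]
          exact hq
      · rw [h₁.mem_of_ne q hqp]
        exact hq
    have hinv : EvalInv n u v J s₁ := by
      obtain ⟨g0, g1, g2, g3, g8, -, -⟩ := hs.of_eq (s' := ⟨s₁.reg, s.mem⟩) rfl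
        fun r _ h4 h5 h6 => h₁.reg r h4 h5 h6
      refine ⟨g0, g1, g2, g3, g8, fun q => ?_, fun q hq => ?_⟩
      · by_cases hqp : q = p
        · by_cases hc : ∀ a ∈ R.1, FactCode.address n s.reg a ∈ s.facts
          · rw [hqp, h₁.mem_pos hc]
          · rw [hqp, h₁.mem_neg hc]
            exact hs.mem_le _
        · rw [h₁.mem_of_ne q hqp]
          exact hs.mem_le _
      · have hq : s₁.mem q ≠ 0 := hq
        by_cases hqp : q = p
        · by_cases hc : ∀ a ∈ R.1, FactCode.address n s.reg a ∈ s.facts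
          · exact hqp ▸ hp hc
          · rw [hqp, h₁.mem_neg hc, ← hqp] at hq
            exact hs.facts hq
        · rw [h₁.mem_of_ne q hqp] at hq
          exact hs.facts hq
    have hreg : ∀ r, 9 ≤ r → s₁.reg r = s.reg r := fun r hr =>
      h₁.reg r (by omega) (by omega) (by omega)
    have hreg8 : ∀ r, 8 ≤ r → s₁.reg r = s.reg r := fun r hr =>
      h₁.reg r (by omega) (by omega) (by omega)
    refine (hb n u v J (fun ρ hρ R' hR' => hJ ρ hρ R' (List.mem_cons_of_mem _ hR')) s₁ hinv
      fun x hx => ?_).mono le_rfl ?_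
    · rw [hreg _ (by omega)]
      exact hval x hx
    · rintro s' ⟨h1, h2, h3, h4⟩
      refine ⟨h1, hfacts.trans h2, fun r hr => (h3 r hr).trans (hreg r hr), fun R' hR' hbody => ?_⟩
      have hadd : ∀ {a : FactCode}, (∀ r ∈ a.2, 8 ≤ r ∧ r < 9 + K) →
          a.address n s₁.reg = a.address n s.reg := fun ha =>
        FactCode.address_congr fun r hr => hreg8 r (ha r hr).1
      rcases List.mem_cons.1 hR' with rfl | hR'
      · refine h2 ?_
        change s₁.mem p ≠ 0
        rw [h₁.mem_pos hbody]
        exact one_ne_zero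
      · have hb := hRs R' (List.mem_cons_of_mem _ hR')
        rw [← hadd hb.2]
        refine h4 R' hR' fun a ha => ?_
        rw [hadd (hb.1 a ha)]
        exact hfacts (hbody a ha)

/-- Nested loops over the registers `9 + a, …, 9 + a + k - 1`. -/
def nestCode (a : ℕ) (p : RamProgram) : ℕ → RamProgram
  | 0 => p
  | k + 1 => .loop (9 + (a + k)) (nestCode a p k)

/-- The memory grows during the loops, so consequences are measured against a fixed set `F` of facts
present at the start. -/
theorem runs_roundCode {K : ℕ} (Rs : List FactRule) (hRs : ∀ R ∈ Rs, R.Bounded K) {k : ℕ}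
    (hk : k ≤ K) :
    ∃ b : Polynomial ℕ, ∀ (n u v : ℕ) (J : Set ℕ), FactRule.Closed n K Rs J → ∀ s : RamState,
      EvalInv n u v J s → (∀ x < K, k ≤ x → s.reg (9 + x) < n) → ∀ F ⊆ s.facts,
      Runs (nestCode 0 (rulesCode Rs) k) s (b.eval n) fun s' => EvalInv n u v J s' ∧
        s.facts ⊆ s'.facts ∧ (∀ r, 9 + k ≤ r → s'.reg r = s.reg r) ∧
        ∀ ρ, IsValuation n K ρ → (∀ x < K, k ≤ x → ρ (9 + x) = s.reg (9 + x)) → ∀ R ∈ Rs,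
          (∀ a ∈ R.1, FactCode.address n ρ a ∈ F) → FactCode.address n ρ R.2 ∈ s'.facts := by
  induction k with
  | zero =>
    obtain ⟨b, hb⟩ := runs_rulesCode Rs hRs
    refine ⟨b, fun n u v J hJ s hs hval F hF =>
      (hb n u v J hJ s hs fun x hx => hval x hx (Nat.zero_le x)).mono le_rfl ?_⟩
    rintro s' ⟨h1, h2, h3, h4⟩
    refine ⟨h1, h2, h3, fun ρ hρ hρs R hR hbody => ?_⟩
    have hadd : ∀ {a : FactCode}, (∀ r ∈ a.2, 8 ≤ r ∧ r < 9 + K) →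
        a.address n ρ = a.address n s.reg := fun ha => by
      refine FactCode.address_congr fun r hr => ?_
      obtain ⟨hr1, hr2⟩ := ha r hr
      by_cases hr8 : r = 8
      · rw [hr8, hρ.1, hs.reg8]
      · obtain ⟨x, rfl⟩ := Nat.exists_eq_add_of_le (show 9 ≤ r by omega)
        exact hρs x (by omega) (Nat.zero_le x)
    rw [hadd (hRs R hR).2]
    refine h4 R hR fun a ha => ?_
    rw [← hadd ((hRs R hR).1 a ha)]
    exact hF (hbody a ha)
  | succ k ih =>
    obtain ⟨b, hb⟩ := ih (by omega)
    refine ⟨.X * (b + 2) + 2, fun n u v J hJ s hs hval F hF => ?_⟩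
    have : (Polynomial.X * (b + 2) + 2).eval n = n * (b.eval n + 2) + 2 := by simp
    rw [this]
    -- With the loop counter at `c`, all valuations whose variable `k` has a value at least `c` have
    -- been treated.
    let Inv : ℕ → RamState → Prop := fun c t => EvalInv n u v J t ∧ s.facts ⊆ t.facts ∧
      (∀ r, 9 + (k + 1) ≤ r → t.reg r = s.reg r) ∧
      ∀ ρ, IsValuation n K ρ → (∀ x < K, k + 1 ≤ x → ρ (9 + x) = s.reg (9 + x)) →
        c ≤ ρ (9 + k) → ∀ R ∈ Rs,
          (∀ a ∈ R.1, FactCode.address n ρ a ∈ F) → FactCode.address n ρ R.2 ∈ t.facts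
    refine (runs_loop (r := 9 + (0 + k)) (n := n) Inv (fun c t ht => ht.1.reg3) ?_ hs.reg0
      ⟨hs.setReg (by omega) _, subset_rfl, fun r hr => setReg_reg_of_ne _ _ (by omega), ?_⟩).mono
      le_rfl ?_
    · rw [zero_add]
      rintro c hc t ⟨h1, h2, h3, h4⟩ hr
      have hreg : ∀ r, 9 + (k + 1) ≤ r → (t.setReg (9 + k) c).reg r = s.reg r := fun r hr =>
        (setReg_reg_of_ne _ _ (by omega)).trans (h3 r hr)
      refine (hb n u v J hJ (t.setReg (9 + k) c) (h1.setReg (by omega) _) ?_ F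
        (hF.trans h2)).mono le_rfl ?_
      · intro x hx hkx
        by_cases hxk : x = k
        · rw [hxk, setReg_reg_self]
          exact hc
        · rw [hreg _ (by omega)]
          exact hval x hx (by omega)
      · rintro s' ⟨g1, g2, g3, g4⟩
        refine ⟨⟨g1, h2.trans g2, fun r hr => (g3 r (by omega)).trans (hreg r hr), ?_⟩,
          (g3 _ le_rfl).trans (setReg_reg_self _ _ _)⟩
        intro ρ hρ hρs hcρ R hR hbody
        by_cases hcρ' : c = ρ (9 + k)
        · refine g4 ρ hρ (fun x hx hkx => ?_) R hR hbody
          by_cases hxk : x = k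
          · rw [hxk, setReg_reg_self, hcρ']
          · rw [hreg _ (by omega)]
            exact hρs x hx (by omega)
        · exact g2 (h4 ρ hρ hρs (by omega) R hR hbody)
    · intro ρ hρ _ hnρ
      have := hρ.2 k (by omega)
      omega
    · rintro s' ⟨h1, h2, h3, h4⟩
      exact ⟨h1, h2, h3, fun ρ hρ hρs => h4 ρ hρ hρs (Nat.zero_le _)⟩

/-- A number of copies of a program, one after the other. -/
def copiesCode (p : RamProgram) : ℕ → RamProgram
  | 0 => .skip
  | k + 1 => .seq p (copiesCode p k)

/-- The progress of the evaluation: it is complete or at least `j` facts are present. -/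
def Progress (n u v : ℕ) (base J : Set ℕ) (j : ℕ) (s : RamState) : Prop :=
  EvalInv n u v J s ∧ base ⊆ s.facts ∧ (J ⊆ s.facts ∨ j ≤ s.facts.ncard)

/-- What is needed of the facts `J` for the evaluation of the rules `Rs` on `base`. -/
structure IsLeastModel (n K : ℕ) (Rs : List FactRule) (base J : Set ℕ) : Prop where
  finite : J.Finite
  closed : FactRule.Closed n K Rs J
  least : ∀ X, base ⊆ X → FactRule.Closed n K Rs X → J ⊆ X

/-- If a round adds nothing, the present facts are closed and contain `base`, hence contain the
least model `J`; otherwise their number grows. -/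
theorem runs_round {K : ℕ} (Rs : List FactRule) (hRs : ∀ R ∈ Rs, R.Bounded K) :
    ∃ b : Polynomial ℕ, ∀ (n u v : ℕ) (base J : Set ℕ), IsLeastModel n K Rs base J →
      ∀ (j : ℕ) (s : RamState), Progress n u v base J j s →
      Runs (nestCode 0 (rulesCode Rs) K) s (b.eval n) fun s' =>
        Progress n u v base J (j + 1) s' ∧ ∀ r, 9 + K ≤ r → s'.reg r = s.reg r := by
  obtain ⟨b, hb⟩ := runs_roundCode Rs hRs le_rfl
  refine ⟨b, fun n u v base J hJ j s ⟨hs, hbase, hj⟩ =>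
    (hb n u v J hJ.closed s hs (fun x hx hx' => by omega) s.facts subset_rfl).mono le_rfl ?_⟩
  rintro s' ⟨h1, h2, h3, h4⟩
  refine ⟨⟨h1, hbase.trans h2, ?_⟩, h3⟩
  rcases hj with hj | hj
  · exact .inl (hj.trans h2)
  · by_cases heq : s'.facts ⊆ s.facts
    · refine .inl ((hJ.least _ hbase fun ρ hρ R hR hbody => heq ?_).trans h2)
      exact h4 ρ hρ (fun x hx hx' => by omega) R hR hbody
    · have := Set.ncard_lt_ncard (lt_of_le_not_ge h2 heq) (hJ.finite.subset h1.facts)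
      exact .inr (by omega)

/-- `Prog` stands for `Progress` with its parameters fixed; quantifying over it after the polynomial
keeps the time bound independent of the database. -/
theorem runs_copiesCode {p : RamProgram} {K : ℕ} {Good : ℕ → (ℕ → RamState → Prop) → Prop}
    {b : Polynomial ℕ}
    (hp : ∀ (n : ℕ) (Prog : ℕ → RamState → Prop), Good n Prog → ∀ (j : ℕ) (s : RamState),
      Prog j s → Runs p s (b.eval n) fun s' => Prog (j + 1) s' ∧ ∀ r, 9 + K ≤ r → s'.reg r = s.reg r)
    (M : ℕ) :
    ∃ b : Polynomial ℕ, ∀ (n : ℕ) (Prog : ℕ → RamState → Prop), Good n Prog →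
      ∀ (j : ℕ) (s : RamState), Prog j s → Runs (copiesCode p M) s (b.eval n) fun s' =>
        Prog (j + M) s' ∧ ∀ r, 9 + K ≤ r → s'.reg r = s.reg r := by
  induction M with
  | zero => exact ⟨1, fun n Prog _ j s hs => ⟨1, s, .skip s, by simp, hs, fun _ _ => rfl⟩⟩
  | succ M ih =>
    obtain ⟨b', hb'⟩ := ih
    refine ⟨b + b', fun n Prog hg j s hs => ?_⟩
    have : (b + b').eval n = b.eval n + b'.eval n := by simp
    rw [this]
    refine Runs.seq ((hp n Prog hg j s hs).mono le_rfl ?_)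
    rintro s₁ ⟨h1, h2⟩
    refine (hb' n Prog hg (j + 1) s₁ h1).mono le_rfl ?_
    rintro s' ⟨h3, h4⟩
    refine ⟨?_, fun r hr => (h4 r hr).trans (h2 r hr)⟩
    rwa [show j + (M + 1) = j + 1 + M by omega]

/-- Each of the `d` outer loops multiplies the number of rounds by `n`. Their counters lie from `9 +
K` on, beyond the registers changed by `p`. -/
theorem runs_nestCode {p : RamProgram} {K M : ℕ} {Good : ℕ → (ℕ → RamState → Prop) → Prop}
    {b : Polynomial ℕ}
    (hset : ∀ n Prog, Good n Prog → ∀ j s, Prog j s → s.reg 0 = n ∧ s.reg 3 = 1 ∧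
      ∀ r c, 9 ≤ r → Prog j (s.setReg r c))
    (hp : ∀ (n : ℕ) (Prog : ℕ → RamState → Prop), Good n Prog → ∀ (j : ℕ) (s : RamState),
      Prog j s → Runs p s (b.eval n) fun s' => Prog (j + M) s' ∧ ∀ r, 9 + K ≤ r → s'.reg r = s.reg r)
    (d : ℕ) :
    ∃ b : Polynomial ℕ, ∀ (n : ℕ) (Prog : ℕ → RamState → Prop), Good n Prog →
      ∀ (j : ℕ) (s : RamState), Prog j s → Runs (nestCode K p d) s (b.eval n) fun s' =>
        Prog (j + M * n ^ d) s' ∧ ∀ r, 9 + (K + d) ≤ r → s'.reg r = s.reg r := by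
  induction d with
  | zero =>
    refine ⟨b, fun n Prog hg j s hs => ?_⟩
    rw [pow_zero, mul_one]
    exact hp n Prog hg j s hs
  | succ d ih =>
    obtain ⟨b', hb'⟩ := ih
    refine ⟨.X * (b' + 2) + 2, fun n Prog hg j s hs => ?_⟩
    have : (Polynomial.X * (b' + 2) + 2).eval n = n * (b'.eval n + 2) + 2 := by simp
    rw [this]
    refine (runs_loop (r := 9 + (K + d)) (n := n)
      (fun c t => Prog (j + (n - c) * (M * n ^ d)) t ∧
        ∀ r, 9 + (K + (d + 1)) ≤ r → t.reg r = s.reg r)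
      (fun c t ht => (hset n Prog hg _ _ ht.1).2.1) ?_ (hset n Prog hg _ _ hs).1
      ⟨?_, fun r hr => setReg_reg_of_ne _ _ (by omega)⟩).mono le_rfl ?_
    · rintro c hc t ⟨h1, h2⟩ hr
      refine (hb' n Prog hg _ _ ((hset n Prog hg _ _ h1).2.2 (9 + (K + d)) c (by omega))).mono
        le_rfl ?_
      rintro s' ⟨h3, h4⟩
      refine ⟨⟨?_, fun r hr => ?_⟩, (h4 _ le_rfl).trans (setReg_reg_self _ _ _)⟩
      · rw [show n - c = n - (c + 1) + 1 by omega, Nat.succ_mul, ← Nat.add_assoc]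
        exact h3
      · rw [h4 r (by omega), setReg_reg_of_ne _ _ (by omega), h2 r hr]
    · rw [Nat.sub_self, zero_mul]
      exact (hset n Prog hg _ _ hs).2.2 _ _ (by omega)
    · rintro s' ⟨h1, h2⟩
      refine ⟨?_, h2⟩
      rwa [Nat.sub_zero, show n * (M * n ^ d) = M * n ^ (d + 1) by ring] at h1

/-- The naive evaluation of some rules, with `M * n ^ d` rounds, followed by a test whether the
fact `goal` is present. -/
def evaluationCode (K M d : ℕ) (Rs : List FactRule) (goal : FactCode) : RamProgram :=
  .seq (.const 3 1) (.seq (nestCode K (copiesCode (nestCode 0 (rulesCode Rs) K) M) d)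
    (.seq goal.code (.load 0 4)))

theorem runs_evaluationCode {K : ℕ} (M d : ℕ) (Rs : List FactRule) (hRs : ∀ R ∈ Rs, R.Bounded K)
    (goal : FactCode) (hgoal : ∀ r ∈ goal.2, r = 1 ∨ r = 2 ∨ r = 8) :
    ∃ b : Polynomial ℕ, ∀ (n u v : ℕ) (base J : Set ℕ) (s : RamState),
      IsLeastModel n K Rs base J → J.ncard < M * n ^ d → s.reg 0 = n → s.reg 1 = u →
      s.reg 2 = v → s.reg 8 = 0 → (∀ p, s.mem p ≤ 1) → s.facts = base → base ⊆ J →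
      Runs (evaluationCode K M d Rs goal) s (b.eval n) fun s' =>
        s'.reg 0 ≤ 1 ∧ (s'.reg 0 ≠ 0 ↔ goal.address n s.reg ∈ J) := by
  obtain ⟨b₁, hb₁⟩ := runs_round Rs hRs
  obtain ⟨b₂, hb₂⟩ := runs_copiesCode (K := K)
    (Good := fun n Prog => ∃ u v base J, IsLeastModel n K Rs base J ∧
      Prog = Progress n u v base J) (b := b₁)
    (by rintro n _ ⟨u, v, base, J, hJ, rfl⟩; exact hb₁ n u v base J hJ) M
  obtain ⟨b₃, hb₃⟩ := runs_nestCode (by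
    rintro n _ ⟨u, v, base, J, hJ, rfl⟩ j s ⟨h1, h2, h3⟩
    exact ⟨h1.reg0, h1.reg3, fun r c hr => ⟨h1.setReg hr c, h2, h3⟩⟩) hb₂ d
  obtain ⟨b₄, hb₄⟩ := goal.runs_code fun r hr => by
    have := hgoal r hr
    omega
  refine ⟨1 + (b₃ + (b₄ + 1)), fun n u v base J s hJ hcard h0 h1 h2 h8 hm hfacts hbJ => ?_⟩
  have : (1 + (b₃ + (b₄ + 1))).eval n = 1 + (b₃.eval n + (b₄.eval n + 1)) := by simp
  rw [this]
  refine Runs.seq ⟨1, _, .const 3 1 s, le_rfl, ?_⟩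
  have hinv : EvalInv n u v J (s.setReg 3 1) :=
    ⟨h0, h1, h2, rfl, h8, hm, (show s.facts ⊆ J from hfacts ▸ hbJ)⟩
  refine Runs.seq ((hb₃ n _ ⟨u, v, base, J, hJ, rfl⟩ 0 _
    ⟨hinv, (show base ⊆ s.facts from hfacts ▸ subset_rfl), .inr (Nat.zero_le _)⟩).mono le_rfl ?_)
  rintro s₁ ⟨⟨hs₁, -, hprog⟩, -⟩
  have hJs₁ : J = s₁.facts := by
    refine subset_antisymm ?_ hs₁.facts
    rcases hprog with h | h
    · exact h
    -- There were more rounds than facts in `J`, so they cannot all have added one.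
    · have := Set.ncard_le_ncard hs₁.facts hJ.finite
      omega
  refine Runs.seq ((hb₄ n s₁ hs₁.reg0 hs₁.reg3).mono le_rfl ?_)
  rintro s₂ ⟨h3, h4⟩
  refine ⟨1, _, .load 0 4 s₂, le_rfl, ?_⟩
  beta_reduce
  rw [setReg_reg_self, h3.mem, h4]
  have hadd : goal.address n s₁.reg = goal.address n s.reg := by
    refine FactCode.address_congr fun r hr => ?_
    rcases hgoal r hr with rfl | rfl | rfl
    · rw [hs₁.reg1, h1]
    · rw [hs₁.reg2, h2]
    · rw [hs₁.reg8, h8]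
  rw [hadd]
  exact ⟨hs₁.mem_le _, by rw [hJs₁]; rfl⟩

end Ram

/-! ### Addresses as numbers in base `n`. -/

section Horner

theorem horner_cons (n c x : ℕ) (L : List ℕ) : horner n c (x :: L) = horner n (c * n + x) L := rfl

/-- The leading digit selects a block of `n ^ L.length` consecutive addresses. -/
theorem horner_bounds {n : ℕ} (c : ℕ) (L : List ℕ) (hL : ∀ x ∈ L, x < n) :
    c * n ^ L.length ≤ horner n c L ∧ horner n c L < (c + 1) * n ^ L.length := by
  induction L generalizing c with
  | nil => simp [horner]
  | cons x L ih =>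
    obtain ⟨h1, h2⟩ := ih (c * n + x) fun y hy => hL y (List.mem_cons_of_mem _ hy)
    have hx := hL x (List.mem_cons_self ..)
    rw [horner_cons, List.length_cons]
    constructor
    · calc c * n ^ (L.length + 1) = c * n * n ^ L.length := by ring
        _ ≤ (c * n + x) * n ^ L.length := Nat.mul_le_mul_right _ (Nat.le_add_right _ _)
        _ ≤ _ := h1
    · calc _ < (c * n + x + 1) * n ^ L.length := h2
        _ ≤ ((c + 1) * n) * n ^ L.length := Nat.mul_le_mul_right _ (by rw [Nat.succ_mul]; omega)
        _ = _ := by ring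

theorem horner_injective {n c c' : ℕ} {L L' : List ℕ} (hlen : L.length = L'.length)
    (hL : ∀ x ∈ L, x < n) (hL' : ∀ x ∈ L', x < n) (h : horner n c L = horner n c' L') :
    c = c' ∧ L = L' := by
  induction L generalizing c c' L' with
  | nil =>
    obtain rfl := List.length_eq_zero_iff.1 hlen.symm
    exact ⟨h, rfl⟩
  | cons x L ih =>
    cases L' with
    | nil => simp at hlen
    | cons x' L' =>
      obtain ⟨h1, rfl⟩ := ih (by simpa using hlen) (fun y hy => hL y (List.mem_cons_of_mem _ hy))
        (fun y hy => hL' y (List.mem_cons_of_mem _ hy)) h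
      have hx := hL x (List.mem_cons_self ..)
      have hx' := hL' x' (List.mem_cons_self ..)
      have hn : 0 < n := by omega
      replace h1 : c * n + x = c' * n + x' := h1
      have hmod := congrArg (· % n) h1
      simp only [Nat.mul_add_mod', Nat.mod_eq_of_lt hx,
        Nat.mod_eq_of_lt hx'] at hmod
      subst hmod
      refine ⟨Nat.eq_of_mul_eq_mul_right hn (by omega), rfl⟩

end Horner

/-! ### Compiling Datalog queries to machine programs. -/

section Compilation

variable {τ U : Type*}

/-- By safety, head variables take values in the database; hence valuations by the `n` node numbers
suffice for the evaluation. -/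
theorem DatalogQuery.Derives.mem_nodes {P : DatalogQuery τ} {S : GraphDB τ U}
    {I : Fin P.numInternal} {a : Fin (P.arity I) → U} (h : P.Derives S I a) (j : Fin (P.arity I)) :
    a j ∈ S.nodes := by
  induction h with
  | rule r hr ν hs _ ih =>
    obtain ⟨b, hb, hj⟩ := mem_bodyVars.1 (r.safe j)
    beta_reduce
    cases b with
    | schema i x y =>
      rcases Finset.mem_insert.1 hj with hj | hj
      · rw [hj]
        exact S.left_mem (hs i x y hb)
      · rw [Finset.mem_singleton.1 hj]
        exact S.right_mem (hs i x y hb)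
    | internal I args =>
      obtain ⟨j', -, hj'⟩ := Finset.mem_image.1 hj
      rw [← hj']
      exact ih I args hb j'

theorem DatalogQuery.exists_bound (P : DatalogQuery τ) :
    ∃ K, ∀ r ∈ P.rules, ∀ x ∈ bodyVars r.body, x < K := by
  induction P.rules with
  | nil => exact ⟨0, by simp⟩
  | cons r rs ih =>
    obtain ⟨K, hK⟩ := ih
    refine ⟨max K ((bodyVars r.body).sup id + 1), fun r' hr' x hx => ?_⟩
    rcases List.mem_cons.1 hr' with rfl | hr'
    · exact lt_max_of_lt_right (Nat.lt_succ_of_le (Finset.le_sup (f := id) hx))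
    · exact lt_max_of_lt_left (hK r' hr' x hx)

variable {m : ℕ} (e : τ ≃ Fin m) (P : DatalogQuery τ) (d : ℕ)

/-- The registers (or numbers) of a fact over the internal symbol `I`, padded to length `d`. -/
def padded {k : ℕ} (d : ℕ) (z : ℕ) (a : Fin k → ℕ) : List ℕ :=
  List.ofFn a ++ List.replicate (d - k) z

theorem length_padded {k d z : ℕ} (a : Fin k → ℕ) (h : k ≤ d) : (padded d z a).length = d := by
  simp [padded, h]

theorem mem_padded {k d z x : ℕ} {a : Fin k → ℕ} (h : x ∈ padded d z a) :
    x = z ∨ ∃ j, x = a j := by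
  rcases List.mem_append.1 h with h | h
  · obtain ⟨j, rfl⟩ := List.mem_ofFn.1 h
    exact .inr ⟨j, rfl⟩
  · exact .inl (List.eq_of_mem_replicate h)

theorem map_padded {k d z : ℕ} (a : Fin k → ℕ) (f : ℕ → ℕ) :
    (padded d z a).map f = padded d (f z) fun j => f (a j) := by
  simp [padded, List.map_ofFn, Function.comp_def]

theorem padded_injective {k d z : ℕ} {a b : Fin k → ℕ} (h : padded d z a = padded d z b) :
    a = b :=
  List.ofFn_injective (List.append_left_injective _ h)

/-- The code of an atom: the variable `x` is kept in the register `9 + x`. -/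
def atomCode : DatalogAtom τ P.arity → FactCode
  | .schema i x y => (e i, [9 + x, 9 + y])
  | .internal I args => (m + I, padded d 8 fun j => 9 + args j)

/-- The code of a rule. -/
def datalogRuleCode (r : DatalogRule τ P.arity) : FactRule :=
  (r.body.map (atomCode e P d), atomCode e P d (.internal r.head r.headArgs))

theorem datalogRuleCode_bounded {K : ℕ} {r : DatalogRule τ P.arity}
    (hK : ∀ x ∈ bodyVars r.body, x < K) : (datalogRuleCode e P d r).Bounded K := by
  have key : ∀ a : DatalogAtom τ P.arity, (∀ x ∈ a.vars, x < K) →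
      ∀ r ∈ (atomCode e P d a).2, 8 ≤ r ∧ r < 9 + K := by
    rintro (⟨i, x, y⟩ | ⟨I, args⟩) ha r hr
    · have hx := ha x (by simp [DatalogAtom.vars])
      have hy := ha y (by simp [DatalogAtom.vars])
      have : r = 9 + x ∨ r = 9 + y := by simpa [atomCode] using hr
      omega
    · rcases mem_padded hr with rfl | ⟨j, rfl⟩
      · omega
      · have := ha (args j) (Finset.mem_image_of_mem _ (Finset.mem_univ j))
        omega
  constructor
  · intro a ha
    obtain ⟨b, hb, rfl⟩ := List.mem_map.1 ha
    exact key b fun x hx => hK x (mem_bodyVars.2 ⟨b, hb, hx⟩)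
  · refine key _ fun x hx => ?_
    obtain ⟨j, -, rfl⟩ := Finset.mem_image.1 hx
    exact hK _ (r.safe j)

variable (S : GraphDB τ U) {n : ℕ} (f : S.nodes ≃ Fin n)

/-- The address of a fact over an internal symbol. -/
def internalAddress (n : ℕ) (I : Fin P.numInternal) (a : Fin (P.arity I) → ℕ) : ℕ :=
  horner n (m + I) (padded d 0 a)

/-- The addresses of the given facts. -/
def schemaAddresses : Set ℕ :=
  {p | ∃ (i : τ) (x y : S.nodes), p = ((e i : ℕ) * n + f x) * n + f y ∧ S.edge i x y}

/-- The addresses of the given and of the derived facts. -/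
def derivedAddresses : Set ℕ :=
  schemaAddresses e S f ∪ {p | ∃ (I : Fin P.numInternal) (a : Fin (P.arity I) → S.nodes),
    P.Derives S I (fun j => a j) ∧ p = internalAddress (m := m) P d n I fun j => f (a j)}

variable {e P d S f}

/-- Padding gives every internal fact `d` digits after a leading digit at least `m`. These addresses
are disjoint from the given ones, which lie below `m * n ^ d` once `2 ≤ d`. -/
theorem internalAddress_bounds (hd : ∀ I, P.arity I ≤ d) {I : Fin P.numInternal}
    {a : Fin (P.arity I) → ℕ} (hn : 0 < n) (ha : ∀ j, a j < n) :
    m * n ^ d ≤ internalAddress (m := m) P d n I a ∧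
      internalAddress (m := m) P d n I a < (m + P.numInternal) * n ^ d := by
  have hb := horner_bounds (n := n) (m + I) (padded d 0 a) (by
    intro x hx
    rcases mem_padded hx with rfl | ⟨j, rfl⟩
    exacts [hn, ha j])
  rw [length_padded a (hd I)] at hb
  refine ⟨(Nat.mul_le_mul_right _ (Nat.le_add_right _ _)).trans hb.1, hb.2.trans_le ?_⟩
  exact Nat.mul_le_mul_right _ (by omega)

theorem internalAddress_injective (hd : ∀ I, P.arity I ≤ d) {I J : Fin P.numInternal}
    {a : Fin (P.arity I) → ℕ} {b : Fin (P.arity J) → ℕ} (hn : 0 < n) (ha : ∀ j, a j < n)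
    (hb : ∀ j, b j < n)
    (h : internalAddress (m := m) P d n I a = internalAddress (m := m) P d n J b) :
    (⟨I, a⟩ : Σ I, Fin (P.arity I) → ℕ) = ⟨J, b⟩ := by
  obtain ⟨h1, h2⟩ := horner_injective
    ((length_padded a (hd I)).trans (length_padded b (hd J)).symm)
    (fun x hx => by
      rcases mem_padded hx with rfl | ⟨j, rfl⟩
      exacts [hn, ha j])
    (fun x hx => by
      rcases mem_padded hx with rfl | ⟨j, rfl⟩
      exacts [hn, hb j]) h
  obtain rfl : I = J := Fin.ext (by omega)
  rw [padded_injective h2]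

theorem schemaAddress_lt (hd : 2 ≤ d) (hn : 0 < n) {p : ℕ} (hp : p ∈ schemaAddresses e S f) :
    p < m * n ^ d := by
  obtain ⟨i, x, y, rfl, -⟩ := hp
  have := (horner_bounds (n := n) (e i) [(f x : ℕ), f y] (by simp)).2
  calc _ < (e i + 1) * n ^ 2 := this
    _ ≤ m * n ^ d := Nat.mul_le_mul (e i).2 (Nat.pow_le_pow_right hn hd)

theorem schemaAddress_mem_iff (hd : 2 ≤ d) (hd' : ∀ I, P.arity I ≤ d) (hn : 0 < n) {i : τ}
    {x y : S.nodes} :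
    ((e i : ℕ) * n + f x) * n + f y ∈ derivedAddresses e P d S f ↔ S.edge i x y := by
  constructor
  · rintro (⟨i', x', y', h, hxy⟩ | ⟨J, b, hb, h⟩)
    · obtain ⟨h1, h2⟩ := horner_injective (n := n) (L := [(f x : ℕ), f y])
        (L' := [(f x' : ℕ), f y']) rfl (by simp) (by simp) h
      obtain rfl := e.injective (Fin.ext h1)
      simp only [List.cons.injEq, and_true] at h2
      obtain rfl := f.injective (Fin.ext h2.1)
      obtain rfl := f.injective (Fin.ext h2.2)
      exact hxy
    · have h1 := (horner_bounds (n := n) (e i) [(f x : ℕ), f y] (by simp)).2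
      have h2 : ((e i : ℕ) + 1) * n ^ 2 ≤ m * n ^ d :=
        Nat.mul_le_mul (e i).2 (Nat.pow_le_pow_right hn hd)
      have h3 := (internalAddress_bounds (m := m) hd' (I := J) (a := fun j => f (b j)) hn
        fun j => (f (b j)).2).1
      exact absurd h (((h1.trans_le h2).trans_le h3).ne)
  · exact fun h => .inl ⟨i, x, y, rfl, h⟩

theorem internalAddress_mem_iff (hd : 2 ≤ d) (hd' : ∀ I, P.arity I ≤ d) (hn : 0 < n)
    {I : Fin P.numInternal} {a : Fin (P.arity I) → S.nodes} :
    internalAddress (m := m) P d n I (fun j => f (a j)) ∈ derivedAddresses e P d S f ↔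
      P.Derives S I fun j => a j := by
  constructor
  · rintro (h | ⟨J, b, hb, h⟩)
    · have h1 := schemaAddress_lt hd hn h
      have h2 := (internalAddress_bounds (m := m) hd' (I := I) (a := fun j => f (a j)) hn
        fun j => (f (a j)).2).1
      omega
    · have := internalAddress_injective hd' hn (fun j => (f (a j)).2) (fun j => (f (b j)).2) h
      obtain rfl : I = J := congrArg Sigma.fst this
      have hab := eq_of_heq (Sigma.mk.inj this).2
      obtain rfl : a = b := funext fun j => f.injective (Fin.ext (congrFun hab j))
      exact hb
  · exact fun h => .inr ⟨I, a, h, rfl⟩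

theorem derivedAddresses_subset (hd : 2 ≤ d) (hd' : ∀ I, P.arity I ≤ d) (hn : 0 < n) :
    derivedAddresses e P d S f ⊆ Finset.range ((m + P.numInternal) * n ^ d) := by
  rintro p (h | ⟨J, b, hb, rfl⟩)
  · refine Finset.mem_coe.2 (Finset.mem_range.2 ((schemaAddress_lt hd hn h).trans_le ?_))
    exact Nat.mul_le_mul_right _ (Nat.le_add_right _ _)
  · exact Finset.mem_coe.2 (Finset.mem_range.2
      (internalAddress_bounds hd' hn fun j => (f (b j)).2).2)

theorem address_schema {ρ : ℕ → ℕ} {i : τ} {x y : ℕ} {a b : S.nodes} (hx : ρ (9 + x) = f a)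
    (hy : ρ (9 + y) = f b) :
    (atomCode e P d (.schema i x y)).address n ρ = ((e i : ℕ) * n + f a) * n + f b := by
  simp [atomCode, FactCode.address, horner, hx, hy]

theorem address_internal {ρ : ℕ → ℕ} (h8 : ρ 8 = 0) {I : Fin P.numInternal}
    {args : Fin (P.arity I) → ℕ} {a : Fin (P.arity I) → S.nodes}
    (h : ∀ j, ρ (9 + args j) = f (a j)) :
    (atomCode e P d (.internal I args)).address n ρ =
      internalAddress (m := m) P d n I fun j => f (a j) := by
  simp only [atomCode, FactCode.address, internalAddress, map_padded, h8, h]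

theorem isLeastModel_derivedAddresses {K : ℕ} (hd : 2 ≤ d) (hd' : ∀ I, P.arity I ≤ d) (hn : 0 < n)
    (hK : ∀ r ∈ P.rules, ∀ x ∈ bodyVars r.body, x < K) :
    IsLeastModel n K (P.rules.map (datalogRuleCode e P d)) (schemaAddresses e S f)
      (derivedAddresses e P d S f) := by
  classical
  refine ⟨(Finset.finite_toSet _).subset (derivedAddresses_subset hd hd' hn), ?_, ?_⟩
  · rintro ρ ⟨h8, hρ⟩ R hR hbody
    obtain ⟨r, hr, rfl⟩ := List.mem_map.1 hR
    -- Registers are read back as a valuation; variables from `K` on do not occur in the rules and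
    -- get the node numbered `0`.
    let ν : ℕ → S.nodes := fun x => f.symm (if h : x < K then ⟨ρ (9 + x), hρ x h⟩ else ⟨0, hn⟩)
    have hν : ∀ a ∈ r.body, ∀ x ∈ a.vars, ρ (9 + x) = f (ν x) := by
      intro a ha x hx
      have := hK r hr x (mem_bodyVars.2 ⟨a, ha, hx⟩)
      simp [ν, this]
    have hhead : ∀ j, ρ (9 + r.headArgs j) = f (ν (r.headArgs j)) := by
      intro j
      obtain ⟨a, ha, hx⟩ := mem_bodyVars.1 (r.safe j)
      exact hν a ha _ hx
    have hmem : ∀ a ∈ r.body, (atomCode e P d a).address n ρ ∈ derivedAddresses e P d S f :=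
      fun a ha => hbody _ (List.mem_map_of_mem ha)
    change (atomCode e P d (.internal r.head r.headArgs)).address n ρ ∈ _
    rw [address_internal h8 (f := f) (a := fun j => ν (r.headArgs j)) hhead,
      internalAddress_mem_iff hd hd' hn]
    refine .rule r hr (fun x => (ν x : U)) (fun i x y h => ?_) fun I args h => ?_
    · have := hmem _ h
      rwa [address_schema (f := f) (hν _ h x (by simp [DatalogAtom.vars]))
        (hν _ h y (by simp [DatalogAtom.vars])), schemaAddress_mem_iff hd hd' hn] at this
    · have := hmem _ h
      rwa [address_internal h8 (f := f) (a := fun j => ν (args j)) fun j =>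
        hν _ h _ (Finset.mem_image_of_mem _ (Finset.mem_univ j)),
        internalAddress_mem_iff hd hd' hn] at this
  · intro X hX hclosed
    have key : ∀ (I : Fin P.numInternal) (a : Fin (P.arity I) → U), P.Derives S I a →
        ∀ a' : Fin (P.arity I) → S.nodes, (∀ j, (a' j : U) = a j) →
          internalAddress (m := m) P d n I (fun j => f (a' j)) ∈ X := by
      intro I a h
      induction h with
      | rule r hr ν hs hi ih =>
        intro a' ha'
        -- Conversely, a valuation of a derivation may leave `S` on variables not in the body; those
        -- registers get `0`, which is a legal value as `0 < n`.
        let ρ : ℕ → ℕ := fun x => if x < 9 then 0 else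
          if h : ν (x - 9) ∈ S.nodes then f ⟨ν (x - 9), h⟩ else 0
        have hρ : ∀ {x : ℕ} {y : S.nodes}, (y : U) = ν x → ρ (9 + x) = f y := by
          rintro x ⟨y, hy⟩ rfl
          have : ¬ 9 + x < 9 := by omega
          simp only [ρ, this, if_false, Nat.add_sub_cancel_left, hy, dite_true]
        have h8 : ρ 8 = 0 := rfl
        have hval : IsValuation n K ρ := by
          refine ⟨h8, fun x _ => ?_⟩
          simp only [ρ]
          split_ifs
          exacts [hn, Fin.is_lt _, hn]
        have := hclosed ρ hval _ (List.mem_map_of_mem hr) (by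
          intro c hc
          obtain ⟨b, hb, rfl⟩ := List.mem_map.1 hc
          cases b with
          | schema i x y =>
            have hxy := hs i x y hb
            rw [address_schema (f := f) (a := ⟨ν x, S.left_mem hxy⟩) (b := ⟨ν y, S.right_mem hxy⟩)
              (hρ rfl) (hρ rfl)]
            exact hX ⟨i, _, _, rfl, hxy⟩
          | internal I args =>
            have hn' := (hi I args hb).mem_nodes
            rw [address_internal h8 (f := f) (a := fun j => ⟨ν (args j), hn' j⟩) fun j => hρ rfl]
            exact ih I args hb _ fun j => rfl)
        change (atomCode e P d (.internal r.head r.headArgs)).address n ρ ∈ X at this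
        rwa [address_internal h8 (f := f) (a := a') fun j => hρ (ha' j)] at this
    rintro p (h | ⟨I, a, ha, rfl⟩)
    · exact hX h
    · exact key I _ ha a fun j => rfl

/-- Datalog queries have polynomial time data complexity. -/
theorem polynomialTimeQuery_eval (P : DatalogQuery τ) :
    PolynomialTimeQuery (P.eval : GraphDB τ U → Set (U × U)) := by
  classical
  intro m e
  obtain ⟨K, hK⟩ := P.exists_bound
  obtain ⟨d, hd, hd'⟩ : ∃ d, 2 ≤ d ∧ ∀ I, P.arity I ≤ d :=
    ⟨2 + ∑ I, P.arity I, by omega, fun I =>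
      (Finset.single_le_sum (fun _ _ => Nat.zero_le _) (Finset.mem_univ I)).trans (by omega)⟩
  -- The arguments of the goal are read from the input registers `1` and `2`, the padding from
  -- register `8`, which holds `0`.
  let goal : FactCode := (m + P.goal, padded d 8 fun j => ![1, 2] (Fin.cast P.goal_arity j))
  have hgoal : ∀ r ∈ goal.2, r = 1 ∨ r = 2 ∨ r = 8 := by
    intro r hr
    rcases mem_padded hr with rfl | ⟨j, rfl⟩
    · simp
    · generalize Fin.cast P.goal_arity j = k
      fin_cases k <;> simp
  -- All facts have addresses below `(m + P.numInternal) * n ^ d`; the extra `1` makes the number of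
  -- rounds strictly larger.
  obtain ⟨b, hb⟩ := runs_evaluationCode (K := K) (m + P.numInternal + 1) d
    (P.rules.map (datalogRuleCode e P d)) (by
      intro R hR
      obtain ⟨r, hr, rfl⟩ := List.mem_map.1 hR
      exact datalogRuleCode_bounded e P d (hK r hr)) goal hgoal
  refine ⟨evaluationCode K (m + P.numInternal + 1) d (P.rules.map (datalogRuleCode e P d)) goal, b,
    fun S n f u v => ?_⟩
  have hn : 0 < n := (Nat.zero_le _).trans_lt (f u).2
  have hfacts : (ramInput e S f u v).facts = schemaAddresses e S f := by
    ext p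
    simp [RamState.facts, ramInput, schemaAddresses]
  obtain ⟨t, s, h1, h2, h3, h4⟩ := hb n (f u) (f v) (schemaAddresses e S f)
    (derivedAddresses e P d S f) (ramInput e S f u v)
    (isLeastModel_derivedAddresses hd hd' hn hK) (by
      have h1 := Set.ncard_le_ncard (derivedAddresses_subset (e := e) (S := S) (f := f) hd hd' hn)
        (Finset.finite_toSet _)
      rw [Set.ncard_coe_finset, Finset.card_range] at h1
      refine h1.trans_lt ?_
      exact Nat.mul_lt_mul_of_pos_right (Nat.lt_succ_self _) (Nat.pow_pos hn))
    rfl rfl rfl rfl (fun p => by simp only [ramInput]; split_ifs <;> simp) hfacts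
    Set.subset_union_left
  refine ⟨t, s, h1, h2, ?_⟩
  have haddr : goal.address n (ramInput e S f u v).reg =
      internalAddress (m := m) P d n P.goal
        fun j => f ((fun j => ![u, v] (Fin.cast P.goal_arity j)) j) := by
    simp only [goal, FactCode.address, internalAddress, map_padded]
    congr 2
    funext j
    generalize Fin.cast P.goal_arity j = k
    fin_cases k <;> rfl
  rw [haddr, internalAddress_mem_iff hd hd' hn] at h4
  have heval : ((u : U), (v : U)) ∈ P.eval S ↔ s.reg 0 ≠ 0 := by
    rw [h4]
    change P.Derives S P.goal _ ↔ _
    have : (fun j => ![(u : U), v] (Fin.cast P.goal_arity j)) =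
        fun j => ((![u, v] (Fin.cast P.goal_arity j) : S.nodes) : U) := by
      funext j
      generalize Fin.cast P.goal_arity j = k
      fin_cases k <;> rfl
    rw [← this]
  by_cases h0 : s.reg 0 = 0
  · rw [if_neg (by rw [heval]; exact not_not.2 h0), h0]
  · rw [if_pos (heval.2 h0)]
    omega

end Compilation

end ViewRewriting

/-! ### The rewriting theorem. -/

open ViewRewriting

theorem mainTheorem1 {σ τ U : Type*} [Finite σ] [Finite τ] [Infinite U]
    (V : τ → RegularExpression σ) (Q : RegularExpression σ)
    (hV : ∀ i, [] ∉ (V i).matches')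
    (hVQ : DeterminesMonotonically U V Q) :
    ∃ (l : ℕ) (P : DatalogQuery τ),
      P.IsCanonical U l (l + 1) (templateQV Q V) ∧
      IsRewriting V Q (P.eval : GraphDB τ U → Set (U × U)) ∧
      PolynomialTimeQuery (P.eval : GraphDB τ U → Set (U × U)) := by
  have : Finite (Set.range Q.matches'.leftQuotient) := Q.finite_range_leftQuotient.to_subtype
  -- `l` counts the pairs of a quotient class and a template node, the most pebbles kept between
  -- steps of the sweep.
  obtain ⟨l, hl⟩ : ∃ l, Nat.card ((∀ i, Set.range (V i).matches'.leftQuotient) ×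
      Set (Set.range Q.matches'.leftQuotient)) ≤ l := ⟨_, le_rfl⟩
  obtain ⟨P, hP⟩ := exists_isCanonical U (templateQV Q V) l
  refine ⟨l, P, hP, fun D => ?_, polynomialTimeQuery_eval P⟩
  rw [hP.2 _ (viewInstance_noIsolated V D)]
  ext ⟨u, v⟩
  constructor
  · rintro ⟨hu, -, hw⟩
    by_contra huv
    obtain ⟨h, hh⟩ := exists_isTemplateHom V Q (viewInstance_nodes_subset V D hu) huv
    exact hh.not_player1Wins hw
  · intro huv
    exact ⟨(hVQ.1.mem_nodes huv).1, (hVQ.1.mem_nodes huv).2, hVQ.player1Wins hV huv hl⟩
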